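/- A curve over a field $k$ means a smooth projective geometrically connected algebraic curve over $k$. Its gonality $\gamma(C)$ over $k$ is the least degree of a nonconstant $k$-morphism $C\to\mathbb P^1_k$. A tower of curves over $k$ is a sequence of curves $C_n$ ($n\ge 0$) over $k$ together with nonconstant $k$-morphisms $\varphi_n:C_n\to C_{n-1}$ ($n\ge 1$) of degree $>1$; its gonality is $\limsup_n\gamma(C_n)\in\mathbb N\cup\{\infty\}$. Let $\mathcal C=(\{C_n\}_{n\ge0},\{\varphi_n\}_{n\ge1})$ be a tower of curves over a number field $K$, let $\wp$ be a nonzero prime of the ring of integers $\mathcal O$ of $K$, let $\mathcal O_{(\wp)}$ be the localization at $\wp$ and $k_\wp$ its (finite) residue field. Suppose that $\wp$ is a prime of good reduction of the tower, i.e. that there are flat proper $\mathcal O_{(\wp)}$-schemes $\mathscr C_n$ and $\mathcal O_{(\wp)}$-morphisms $\mathscr C_n\to\mathscr C_{n-1}$ whose generic fibres are identified with the $C_n$ and the $\varphi_n$, such that the special fibres $\mathscr C_{n,\wp}$ are curves over $k_\wp$ and the induced morphisms $\mathscr C_{n,\wp}\to\mathscr C_{n-1,\wp}$ are nonconstant.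 Suppose moreover that, for such a model, $$\lim_{n\to\infty}\sharp\,\mathscr C_{n,\wp}(k_\wp)=+\infty .$$ Then the tower $\mathcal C$ has infinite gonality, i.e. $\limsup_n\gamma(C_n)=+\infty$, where $\gamma(C_n)$ is the gonality of $C_n$ over $K$. -/

import Mathlib

open CategoryTheory CategoryTheory.Limits AlgebraicGeometry Filter Topology NumberField
open IsDedekindDomain

universe u

noncomputable section

namespace CurveTower

attribute [local instance] MvPolynomial.gradedAlgebra

/-- Projective space of dimension `N` over a field `k`, as a scheme over `Spec k`: the `Proj` of
the polynomial ring in `N + 1` variables, graded by degree. -/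
def projectiveSpace (k : Type u) [Field k] (N : ℕ) : Over (Spec (.of k)) :=
  Over.mk (Proj.toSpecZero (MvPolynomial.homogeneousSubmodule (Fin (N + 1)) k) ≫
    Spec.map (CommRingCat.ofHom
      (algebraMap k (MvPolynomial.homogeneousSubmodule (Fin (N + 1)) k 0))))

/-- A smooth projective geometrically connected algebraic curve over a field `k`. -/
structure IsCurve {k : Type u} [Field k] (C : Over (Spec (.of k))) : Prop where
  smooth : SmoothOfRelativeDimension 1 C.hom
  projective : ∃ (N : ℕ) (i : C ⟶ projectiveSpace k N), IsClosedImmersion i.left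
  geometricallyConnected : GeometricallyConnected C.hom

/-- A morphism is nonconstant if its image has more than one point. -/
def IsNonconstant {X Y : Scheme.{u}} (f : X ⟶ Y) : Prop :=
  (Set.range f).Nontrivial

open Classical in
/-- The degree of a morphism `f : X ⟶ Y` with `X` irreducible: the degree of the extension of
residue fields at the generic point of `X`. For a nonconstant morphism of curves this is the degree
`[k(X) : k(Y)]` of the extension of function fields. -/
def degree {X Y : Scheme.{u}} (f : X ⟶ Y) : ℕ :=
  if _h : IrreducibleSpace X then f.residueDegree (genericPoint X) else 0

/-- The gonality of a curve `C` over `k`: the least degree of a nonconstant `k`-morphism from `C`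
to the projective line. (Such a morphism always exists for a curve.) -/
def gonality {k : Type u} [Field k] (C : Over (Spec (.of k))) : ℕ∞ :=
  sInf {m : ℕ∞ | ∃ f : C ⟶ projectiveSpace k 1, IsNonconstant f.left ∧ m = degree f.left}

/-- The set `C(k)` of `k`-rational points of a scheme over `k`. -/
abbrev RationalPoint {k : Type u} [Field k] (C : Over (Spec (.of k))) : Type u :=
  Over.mk (𝟙 (Spec (.of k))) ⟶ C

/-- Base change of schemes along a ring extension. -/
abbrev baseChange (R S : Type u) [CommRing R] [CommRing S] [Algebra R S] :
    Over (Spec (.of R)) ⥤ Over (Spec (.of S)) :=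
  Over.pullback (Spec.map (CommRingCat.ofHom (algebraMap R S)))

/-- A tower of curves over a field `K`; the morphism `map n` goes from level `n + 1` to
level `n`. -/
structure Tower (K : Type u) [Field K] where
  curve : ℕ → Over (Spec (.of K))
  isCurve : ∀ n, IsCurve (curve n)
  map : ∀ n, curve (n + 1) ⟶ curve n
  nonconstant : ∀ n, IsNonconstant (map n).left
  one_lt_degree : ∀ n, 1 < degree (map n).left

/-- The gonality of a tower is the limit superior of the gonalities of its curves. -/
def Tower.gonality {K : Type u} [Field K] (T : Tower K) : ℕ∞ :=
  limsup (fun n ↦ CurveTower.gonality (T.curve n)) atTop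

/-- A proper (flat) model over `R` of a tower over an `R`-algebra `K` that is a field (typically the
fraction field of `R`): proper flat `R`-schemes, with
morphisms between them, whose generic fibres are the curves and the morphisms of the tower. -/
structure ProperModel {K : Type u} [Field K] (T : Tower K) (R : Type u) [CommRing R]
    [Algebra R K] where
  model : ℕ → Over (Spec (.of R))
  flat : ∀ n, Flat (model n).hom
  proper : ∀ n, IsProper (model n).hom
  map : ∀ n, model (n + 1) ⟶ model n
  genericFibreIso : ∀ n, (baseChange R K).obj (model n) ≅ T.curve n
  genericFibre_map : ∀ n, (baseChange R K).map (map n) ≫ (genericFibreIso n).hom =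
    (genericFibreIso (n + 1)).hom ≫ T.map n

namespace ProperModel

variable {K : Type u} [Field K] {T : Tower K} {R : Type u} [CommRing R] [Algebra R K]
  [IsLocalRing R]

/-- The reduction of the `n`-th curve: the fibre of the model over the residue field of `R`. -/
def reduction (M : ProperModel T R) (n : ℕ) : Over (Spec (.of (IsLocalRing.ResidueField R))) :=
  (baseChange R (IsLocalRing.ResidueField R)).obj (M.model n)

/-- The reduction of the `n`-th morphism of the tower. -/
def reductionMap (M : ProperModel T R) (n : ℕ) : M.reduction (n + 1) ⟶ M.reduction n :=
  (baseChange R (IsLocalRing.ResidueField R)).map (M.map n)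

/-- The model has good reduction: the reductions of the curves are again (smooth, projective,
geometrically connected) curves and the reductions of the morphisms are nonconstant. -/
structure HasGoodReduction (M : ProperModel T R) : Prop where
  isCurve : ∀ n, IsCurve (M.reduction n)
  nonconstant : ∀ n, IsNonconstant (M.reductionMap n).left

end ProperModel

/-- The localization `𝓞_(v)` of the ring of integers of a number field `K` at a nonzero prime `v`,
as a subring of `K`. -/
abbrev localRingAt (K : Type u) [Field K] [NumberField K] (v : HeightOneSpectrum (𝓞 K)) :
    ValuationSubring K :=
  HeightOneSpectrum.valuationSubringAtPrime K v

end CurveTower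

end

namespace CurveTower

section Approximation

variable {L : Type*} [Field L]

lemma exists_pow_valuation_mul_lt_one (V : ValuationSubring L) [IsDiscreteValuationRing V]
    {z : L} (hz : V.valuation z < 1) (y : L) :
    ∃ n : ℕ, ∀ m ≥ n, V.valuation (z ^ m * y) < 1 := by
  rcases eq_or_ne y 0 with rfl | hy
  · exact ⟨0, fun m _ ↦ by simp⟩
  obtain ⟨ϖ, hϖ⟩ := IsDiscreteValuationRing.exists_irreducible V
  obtain ⟨b, hb0, hb⟩ : ∃ b : V, b ≠ 0 ∧ V.valuation (b * y) ≤ 1 := by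
    rcases V.mem_or_inv_mem y with h | h
    · exact ⟨1, one_ne_zero, by simpa using (V.valuation_le_one_iff _).2 h⟩
    · refine ⟨⟨y⁻¹, h⟩, fun h0 ↦ hy ?_, by simp [hy]⟩
      simpa using congrArg Subtype.val h0
  obtain ⟨n, u, hu⟩ := IsDiscreteValuationRing.associated_pow_irreducible hb0 hϖ
  have hzϖ : V.valuation z ≤ V.valuation (ϖ : L) := by
    have hzV : z ∈ V := (V.valuation_le_one_iff z).1 hz.le
    have hmem : (⟨z, hzV⟩ : V) ∈ IsLocalRing.maximalIdeal V := (V.valuation_lt_one_iff _).2 hz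
    rw [hϖ.maximalIdeal_eq, Ideal.mem_span_singleton'] at hmem
    obtain ⟨a, ha⟩ := hmem
    exact (V.valuation_le_iff _ _).2 ⟨a, congrArg Subtype.val ha⟩
  have hb' : V.valuation ((ϖ : L) ^ n) = V.valuation (b : L) := by
    have h : (b : L) * ((u : V) : L) = (ϖ : L) ^ n := by
      simpa using congrArg Subtype.val hu
    rw [← h, map_mul, V.valuation_unit, mul_one]
  refine ⟨n + 1, fun m hm ↦ ?_⟩
  obtain ⟨r, rfl⟩ := Nat.exists_eq_add_of_le hm
  have h1 : V.valuation (z ^ n * y) ≤ 1 := by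
    refine le_trans ?_ hb
    rw [map_mul, map_mul, ← hb', map_pow, map_pow]
    gcongr
  have h2 : z ^ (n + 1 + r) * y = z ^ r * (z * (z ^ n * y)) := by ring
  rw [h2, map_mul, map_mul, map_pow]
  calc _ ≤ 1 * (V.valuation z * 1) := by
        gcongr
        exact pow_le_one₀ zero_le hz.le
    _ < 1 := by simpa using hz

lemma exists_one_lt_valuation_forall_lt_one {ι : Type*} (V : ι → ValuationSubring L)
    [∀ i, IsDiscreteValuationRing (V i)] (hV : Function.Injective V) (i : ι) (s : Finset ι)
    (his : i ∉ s) :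
    ∃ z : L, 1 < (V i).valuation z ∧ ∀ j ∈ s, (V j).valuation z < 1 := by
  classical
  have htop : ∀ j, V j ≠ ⊤ := fun j h ↦ by
    refine IsDiscreteValuationRing.not_isField (V j) ?_
    rw [IsLocalRing.isField_iff_maximalIdeal_eq, eq_bot_iff]
    rintro x hx
    rw [ValuationSubring.valuation_lt_one_iff] at hx
    have hx' : (x : L)⁻¹ ∈ V j := by
      generalize (x : L)⁻¹ = y
      rw [h]
      exact ValuationSubring.mem_top _
    by_contra hx0
    have h0 : (x : L) ≠ 0 := by simpa using hx0
    rw [← ValuationSubring.valuation_le_one_iff, map_inv₀] at hx'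
    rw [inv_le_one₀ (by simpa [zero_lt_iff] using h0)] at hx'
    exact hx'.not_gt hx
  have hpair : ∀ j, j ≠ i → ∃ y : L, 1 < (V i).valuation y ∧ (V j).valuation y < 1 := by
    intro j hj
    have h1 : ¬ V i ≤ V j := fun h ↦ hj
      (hV (ValuationSubring.eq_of_le_of_ne_top _ h (htop j))).symm
    have h2 : ¬ V j ≤ V i := fun h ↦ hj (hV (ValuationSubring.eq_of_le_of_ne_top _ h (htop i)))
    obtain ⟨a, ha, ha'⟩ := SetLike.not_le_iff_exists.1 h1
    obtain ⟨b, hb, hb'⟩ := SetLike.not_le_iff_exists.1 h2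
    rw [← ValuationSubring.valuation_le_one_iff] at ha hb ha' hb'
    rw [not_le] at ha' hb'
    have ha0 : a ≠ 0 := by rintro rfl; simp at ha'
    have hb0 : b ≠ 0 := by rintro rfl; simp at hb'
    refine ⟨b / a, ?_, ?_⟩
    · rw [map_div₀, one_lt_div₀ (by simpa [zero_lt_iff] using ha0)]
      exact ha.trans_lt hb'
    · rw [map_div₀, div_lt_one₀ (by simpa [zero_lt_iff] using ha0)]
      exact hb.trans_lt ha'
  induction s using Finset.induction_on with
  | empty =>
    obtain ⟨z, hz⟩ : ∃ z, z ∉ V i := by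
      by_contra! h
      exact htop i (eq_top_iff.2 fun x _ ↦ h x)
    exact ⟨z, by simpa [← ValuationSubring.valuation_le_one_iff] using hz, by simp⟩
  | insert j s hj ih =>
    simp only [Finset.mem_insert, not_or] at his
    obtain ⟨z, hzi, hzs⟩ := ih his.2
    obtain ⟨y, hyi, hyj⟩ := hpair j (Ne.symm his.1)
    have hn : ∃ n : ℕ, ∀ l ∈ s, (V l).valuation (z ^ (n + 1) * y) < 1 := by
      choose! n hn using fun l (hl : l ∈ s) ↦ exists_pow_valuation_mul_lt_one (V l) (hzs l hl) y
      exact ⟨s.sup n, fun l hl ↦ hn l hl _ ((Finset.le_sup hl).trans (Nat.le_succ _))⟩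
    obtain ⟨n, hn⟩ := hn
    rcases le_or_gt ((V j).valuation z) 1 with hzj | hzj
    · refine ⟨z ^ (n + 1) * y, ?_, ?_⟩
      · rw [map_mul, map_pow]
        calc (1 : (V i).ValueGroup) < (V i).valuation y := hyi
          _ = 1 * (V i).valuation y := (one_mul _).symm
          _ ≤ _ := by gcongr; exact one_le_pow₀ hzi.le
      · intro l hl
        rcases Finset.mem_insert.1 hl with rfl | hl
        · rw [map_mul, map_pow]
          calc _ ≤ 1 * (V l).valuation y := by gcongr; exact pow_le_one₀ zero_le hzj
            _ < 1 := by simpa using hyj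
        · exact hn l hl
    · have hbig : ∀ l, 1 < (V l).valuation z →
          (V l).valuation (z ^ (n + 1) * y / (1 + z ^ (n + 1))) = (V l).valuation y := by
        intro l hl
        have h1 : (V l).valuation (1 + z ^ (n + 1)) = (V l).valuation (z ^ (n + 1)) :=
          Valuation.map_add_eq_of_lt_right (V l).valuation (x := 1) (by
            rw [Valuation.map_one, map_pow]; exact one_lt_pow₀ hl n.succ_ne_zero)
        have h0 : (V l).valuation (z ^ (n + 1)) ≠ 0 := by
          rw [map_pow]; exact pow_ne_zero _ (zero_lt_one.trans hl).ne'
        rw [map_div₀, h1, map_mul, mul_div_assoc, mul_div_cancel₀ _ h0]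
      refine ⟨z ^ (n + 1) * y / (1 + z ^ (n + 1)), by rwa [hbig i hzi], ?_⟩
      intro l hl
      rcases Finset.mem_insert.1 hl with rfl | hl
      · rwa [hbig _ hzj]
      · have h1 : (V l).valuation (1 + z ^ (n + 1)) = (V l).valuation (1 : L) :=
          Valuation.map_add_eq_of_lt_left (V l).valuation (y := z ^ (n + 1)) (by
            rw [map_one, map_pow]; exact pow_lt_one₀ zero_le (hzs l hl) n.succ_ne_zero)
        rw [map_div₀, h1, map_one, div_one]
        exact hn l hl

/-- Weak approximation for finitely many discrete valuation rings of a field. -/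
lemma exists_sub_ite_valuation_lt_one {ι : Type*} [Finite ι] [DecidableEq ι]
    (V : ι → ValuationSubring L) [∀ i, IsDiscreteValuationRing (V i)]
    (hV : Function.Injective V) :
    ∃ x : ι → L, ∀ i j, (V j).valuation (x i - if i = j then 1 else 0) < 1 := by
  cases nonempty_fintype ι
  have key : ∀ i, ∃ x : L, ∀ j, (V j).valuation (x - if i = j then 1 else 0) < 1 := by
    intro i
    obtain ⟨z, hzi, hz⟩ := exists_one_lt_valuation_forall_lt_one V hV i (Finset.univ.erase i)
      (by simp)
    have hv : (V i).valuation (1 + z) = (V i).valuation z :=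
      Valuation.map_add_eq_of_lt_right (V i).valuation (x := 1) (by simpa using hzi)
    have h0 : 1 + z ≠ 0 := by
      intro h
      rw [h, map_zero] at hv
      exact absurd hzi (by simp [← hv])
    refine ⟨z / (1 + z), fun j ↦ ?_⟩
    rcases eq_or_ne i j with rfl | hij
    · have : z / (1 + z) - 1 = - (1 + z)⁻¹ := by field_simp; ring
      rw [if_pos rfl, this, Valuation.map_neg, map_inv₀, hv]
      exact inv_lt_one_of_one_lt₀ hzi
    · have hj := hz j (by simp [hij.symm])
      have hv' : (V j).valuation (1 + z) = (V j).valuation (1 : L) :=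
        Valuation.map_add_eq_of_lt_left (V j).valuation (y := z) (by simpa using hj)
      rw [if_neg hij, sub_zero, map_div₀, hv', map_one, div_one]
      exact hj
  choose x hx using key
  exact ⟨x, hx⟩

end Approximation

end CurveTower

namespace CurveTower

open Polynomial

section Independence

variable {k L : Type*} [Field k] [Field L] [Algebra k L]

lemma eq_zero_of_sum_aeval_mul_eq_zero {ι : Type*} [Fintype ι] [DecidableEq ι]
    (V : ι → ValuationSubring L) (hk : ∀ i c, algebraMap k L c ∈ V i) {u : L} (hu0 : u ≠ 0)
    (hu : ∀ i, (V i).valuation u < 1) (x : ι → L)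
    (hx : ∀ i j, (V j).valuation (x i - if i = j then 1 else 0) < 1)
    (p : ι → k[X]) (hp : ∑ i, aeval u (p i) * x i = 0) : p = 0 := by
  have haeval : ∀ j (q : k[X]), (V j).valuation (aeval u q) ≤ 1 := by
    intro j q
    rw [ValuationSubring.valuation_le_one_iff]
    have huV : u ∈ V j := (ValuationSubring.valuation_le_one_iff _ _).1 (hu j).le
    induction q using Polynomial.induction_on' with
    | add p q hp hq => rw [map_add]; exact add_mem hp hq
    | monomial n a => rw [aeval_monomial]; exact mul_mem (hk j a) (pow_mem huV n)
  have hxV : ∀ i j, (V j).valuation (x i) ≤ 1 := by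
    intro i j
    have h := (ValuationSubring.valuation_le_one_iff _ _).1 (hx i j).le
    rw [ValuationSubring.valuation_le_one_iff]
    have h2 : (if i = j then (1 : L) else 0) ∈ V j := by split_ifs <;> simp [one_mem, zero_mem]
    simpa using add_mem h h2
  have key : ∀ (n : ℕ) (p : ι → k[X]), ∑ i, aeval u (p i) * x i = 0 → ∀ i, (p i).coeff n = 0 := by
    have zero : ∀ p : ι → k[X], ∑ i, aeval u (p i) * x i = 0 → ∀ i, (p i).coeff 0 = 0 := by
      intro p hp j
      have h1 : ∀ i, aeval u (p i) = aeval u (p i).divX * u + algebraMap k L ((p i).coeff 0) := by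
        intro i
        conv_lhs => rw [← divX_mul_X_add (p i)]
        simp
      have h2 : algebraMap k L ((p j).coeff 0) =
          - ∑ i, (aeval u (p i).divX * u * x i + algebraMap k L ((p i).coeff 0) *
            (x i - if i = j then 1 else 0)) := by
        have h3 : ∑ i, algebraMap k L ((p i).coeff 0) * (if i = j then (1 : L) else 0) =
            algebraMap k L ((p j).coeff 0) := by simp
        rw [← h3, eq_neg_iff_add_eq_zero, ← Finset.sum_add_distrib, ← hp]
        refine Finset.sum_congr rfl fun i _ ↦ ?_
        rw [h1 i]
        ring
      by_contra hne
      have hlt : (V j).valuation (algebraMap k L ((p j).coeff 0)) < 1 := by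
        rw [h2, Valuation.map_neg]
        refine Valuation.map_sum_lt _ one_ne_zero fun i _ ↦ Valuation.map_add_lt _ ?_ ?_
        · rw [map_mul, map_mul]
          calc _ ≤ 1 * (V j).valuation u * 1 := by
                gcongr
                · exact haeval j _
                · exact hxV i j
            _ < 1 := by simpa using hu j
        · rw [map_mul]
          calc _ ≤ 1 * (V j).valuation (x i - if i = j then 1 else 0) := by
                gcongr
                exact (ValuationSubring.valuation_le_one_iff _ _).2 (hk j _)
            _ < 1 := by simpa using hx i j
      have hge := (ValuationSubring.valuation_le_one_iff _ _).2 (hk j ((p j).coeff 0)⁻¹)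
      rw [map_inv₀, map_inv₀, inv_le_one₀ (by simpa [zero_lt_iff] using hne)] at hge
      exact hge.not_gt hlt
    intro n
    induction n with
    | zero => exact zero
    | succ n ih =>
      intro p hp i
      have h0 := zero p hp
      rw [← coeff_divX]
      refine ih (fun i ↦ (p i).divX) ?_ i
      have : u * ∑ i, aeval u (p i).divX * x i = 0 := by
        rw [← hp, Finset.mul_sum]
        refine Finset.sum_congr rfl fun i _ ↦ ?_
        conv_rhs => rw [← divX_mul_X_add (p i), h0 i]
        simp only [map_zero, add_zero, map_mul, aeval_X]
        ring
      exact (mul_eq_zero.1 this).resolve_left hu0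
  funext i
  ext n
  simpa using key n p hp i

end Independence

section Evaluation

variable {R K A F : Type*} [CommRing R] [Field K] [Algebra R K] [CommRing A] [Field F]
  [Algebra R A] [Algebra A F] [Algebra K F] [Algebra R F] [IsScalarTower R A F]
  [IsScalarTower R K F]

lemma aeval_algebraMap_map (b : A) (P : R[X]) :
    aeval (algebraMap A F b) (P.map (algebraMap R K)) = algebraMap A F (aeval b P) := by
  rw [aeval_map_algebraMap, aeval_algebraMap_apply]

lemma map_aeval_eq_aeval_map_residue {R A L : Type*} [CommRing R] [IsLocalRing R] [CommRing A]
    [Algebra R A] [Field L] [Algebra (IsLocalRing.ResidueField R) L] (ρ : A →+* L)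
    (hρ : ∀ r : R, ρ (algebraMap R A r) = algebraMap _ L (IsLocalRing.residue R r))
    (b : A) (P : R[X]) :
    ρ (aeval b P) = aeval (ρ b) (P.map (IsLocalRing.residue R)) := by
  have : ρ.comp (algebraMap R A) =
    (algebraMap (IsLocalRing.ResidueField R) L).comp (IsLocalRing.residue R) := RingHom.ext hρ
  rw [aeval_def, aeval_def, hom_eval₂, eval₂_map, this]

end Evaluation

section Scaling

variable {R K : Type*} [CommRing R] [IsDomain R] [ValuationRing R] [Field K] [Algebra R K]
  [IsFractionRing R K]

/-- A nonzero finite family of polynomials over the fraction field of a valuation ring is a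
constant multiple of a family of integral polynomials with nonzero reduction. -/
lemma exists_eq_C_mul_map_of_ne_zero {ι : Type*} [Finite ι] (p : ι → K[X]) (hp : p ≠ 0) :
    ∃ (c : K) (P : ι → R[X]), c ≠ 0 ∧ (∀ i, p i = C c * (P i).map (algebraMap R K)) ∧
      ∃ i, (P i).map (IsLocalRing.residue R) ≠ 0 := by
  classical
  cases nonempty_fintype ι
  obtain ⟨i₁, hi₁⟩ := Function.ne_iff.1 hp
  obtain ⟨n₁, hn₁⟩ : ∃ n, (p i₁).coeff n ≠ 0 := by
    by_contra! h
    exact hi₁ (Polynomial.ext h)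
  let v := ValuationRing.valuation R K
  let N := Finset.univ.sup fun i ↦ (p i).natDegree + 1
  have hN : ∀ i n, (p i).coeff n ≠ 0 → n ∈ Finset.range N := fun i n h ↦ by
    rw [Finset.mem_range]
    exact (Nat.lt_succ_of_le (le_natDegree_of_ne_zero h)).trans_le
      (Finset.le_sup (f := fun i ↦ (p i).natDegree + 1) (Finset.mem_univ i))
  obtain ⟨⟨i₀, n₀⟩, -, hmax⟩ := Finset.exists_max_image (Finset.univ ×ˢ Finset.range N)
    (fun z : ι × ℕ ↦ v ((p z.1).coeff z.2)) ⟨(i₁, n₁), by simpa using hN _ _ hn₁⟩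
  set c := (p i₀).coeff n₀ with hc
  have hmax' : ∀ i n, v ((p i).coeff n) ≤ v c := fun i n ↦ by
    by_cases h : (p i).coeff n = 0
    · simp [h]
    · exact hmax (i, n) (by simpa using hN i n h)
  have hc0 : c ≠ 0 := by
    intro h
    have := hmax' i₁ n₁
    simp [h, hn₁] at this
  have hlift : ∀ i, ∃ P : R[X], P.map (algebraMap R K) = C c⁻¹ * p i := by
    intro i
    have : C c⁻¹ * p i ∈ lifts (algebraMap R K) := by
      rw [lifts_iff_coeff_lifts]
      intro n
      rw [coeff_C_mul]
      refine (ValuationRing.mem_integer_iff R K _).1 ((Valuation.mem_integer_iff _ _).2 ?_)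
      rw [map_mul, map_inv₀, inv_mul_le_one₀ (by simpa [zero_lt_iff] using hc0)]
      exact hmax' i n
    exact (mem_lifts _).1 this
  choose P hP using hlift
  refine ⟨c, P, hc0, fun i ↦ ?_, i₀, fun h ↦ ?_⟩
  · rw [hP, ← mul_assoc, ← C_mul, mul_inv_cancel₀ hc0, C_1, one_mul]
  · have h1 : (P i₀).coeff n₀ = 1 := by
      apply IsFractionRing.injective R K
      rw [← coeff_map, hP, coeff_C_mul, ← hc, inv_mul_cancel₀ hc0, map_one]
    have h2 := congrArg (fun q ↦ coeff q n₀) h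
    simp [h1] at h2

variable {A F L : Type*} [CommRing A] [Field F] [Field L] [Algebra R A] [Algebra A F]
  [IsFractionRing A F] [Algebra K F] [Algebra R F] [IsScalarTower R A F] [IsScalarTower R K F]
  [Algebra (IsLocalRing.ResidueField R) L]

lemma eq_zero_of_sum_aeval_mul_eq_zero_of_residue {ι : Type*} [Fintype ι] (ρ : A →+* L)
    (hρ : ∀ r : R, ρ (algebraMap R A r) = algebraMap _ L (IsLocalRing.residue R r))
    (b : A) (a : ι → A)
    (hL : ∀ p : ι → (IsLocalRing.ResidueField R)[X],
      ∑ i, aeval (ρ b) (p i) * ρ (a i) = 0 → p = 0)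
    (p : ι → K[X]) (hp : ∑ i, aeval (algebraMap A F b) (p i) * algebraMap A F (a i) = 0) :
    p = 0 := by
  by_contra hp0
  obtain ⟨c, P, hc, hP, i₀, hi₀⟩ := exists_eq_C_mul_map_of_ne_zero (R := R) p hp0
  have h1 : algebraMap A F (∑ i, aeval b (P i) * a i) = 0 := by
    have h2 : algebraMap K F c * algebraMap A F (∑ i, aeval b (P i) * a i) = 0 := by
      rw [← hp, map_sum, Finset.mul_sum]
      refine Finset.sum_congr rfl fun i _ ↦ ?_
      simp only [hP i, map_mul, aeval_C, aeval_algebraMap_map]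
      ring
    exact (mul_eq_zero.1 h2).resolve_left (by simpa using hc)
  have h3 : ∑ i, aeval b (P i) * a i = 0 := IsFractionRing.injective A F (by simpa using h1)
  have h4 := hL (fun i ↦ (P i).map (IsLocalRing.residue R)) (by
    rw [← map_zero ρ, ← h3, map_sum]
    refine Finset.sum_congr rfl fun i _ ↦ ?_
    rw [map_mul]
    exact congrArg (· * ρ (a i)) (map_aeval_eq_aeval_map_residue ρ hρ b (P i)).symm)
  exact hi₀ (congrFun h4 i₀)

end Scaling

section Finrank

variable {K F : Type*} [Field K] [Field F] [Algebra K F]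

open IntermediateField IntermediateField.algebraAdjoinAdjoin in
lemma card_le_finrank_adjoin_simple {ι : Type*} [Fintype ι] (u : F) (y : ι → F)
    [FiniteDimensional K⟮u⟯ F]
    (h : ∀ p : ι → K[X], ∑ i, aeval u (p i) * y i = 0 → p = 0) :
    Fintype.card ι ≤ Module.finrank K⟮u⟯ F := by
  refine LinearIndependent.fintype_card_le_finrank (b := y) ?_
  rw [← LinearIndependent.iff_fractionRing (R := Algebra.adjoin K {u}), Fintype.linearIndependent_iff]
  intro g hg
  have hex : ∀ i, ∃ p : K[X], aeval u p = g i := fun i ↦ by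
    obtain ⟨x, hx⟩ := g i
    rwa [Algebra.adjoin_singleton_eq_range_aeval] at hx
  choose p hp using hex
  have h0 := h p (by
    rw [← hg]
    refine Finset.sum_congr rfl fun i _ ↦ ?_
    rw [hp i]; rfl)
  intro i
  apply Subtype.ext
  rw [← hp i, h0]
  simp

end Finrank

end CurveTower

namespace CurveTower

open Polynomial

section AdjoinSimple

open IntermediateField

variable {K F : Type*} [Field K] [Field F] [Algebra K F]

lemma adjoin_simple_eq_of_mem {x y : F} (hx : x ∈ K⟮y⟯) (hy : y ∈ K⟮x⟯) : K⟮x⟯ = K⟮y⟯ :=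
  le_antisymm (adjoin_simple_le_iff.2 hx) (adjoin_simple_le_iff.2 hy)

lemma adjoin_simple_algebraMap_mul {c : K} (hc : c ≠ 0) (x : F) :
    K⟮algebraMap K F c * x⟯ = K⟮x⟯ := by
  refine adjoin_simple_eq_of_mem (mul_mem (IntermediateField.algebraMap_mem _ c)
    (mem_adjoin_simple_self K x)) ?_
  have h := mul_mem (IntermediateField.algebraMap_mem K⟮algebraMap K F c * x⟯ c⁻¹)
    (mem_adjoin_simple_self K (algebraMap K F c * x))
  rwa [← mul_assoc, ← map_mul, inv_mul_cancel₀ hc, map_one, one_mul] at h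

lemma adjoin_simple_sub_algebraMap (c : K) (x : F) : K⟮x - algebraMap K F c⟯ = K⟮x⟯ := by
  refine adjoin_simple_eq_of_mem (sub_mem (mem_adjoin_simple_self K x)
    (IntermediateField.algebraMap_mem _ c)) ?_
  simpa using add_mem (mem_adjoin_simple_self K (x - algebraMap K F c))
    (IntermediateField.algebraMap_mem K⟮x - algebraMap K F c⟯ c)

lemma adjoin_simple_inv (x : F) : K⟮x⁻¹⟯ = K⟮x⟯ := by
  refine adjoin_simple_eq_of_mem (inv_mem (mem_adjoin_simple_self K x)) ?_
  simpa using inv_mem (mem_adjoin_simple_self K x⁻¹)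

open IntermediateField.algebraAdjoinAdjoin in
/-- A nontrivial algebraic relation over `K⟮t⟯` with coefficients polynomials in `t`. -/
lemma exists_sum_range_pow_mul_aeval_eq_zero (t : F) [Algebra.IsAlgebraic K⟮t⟯ F] (s : F) :
    ∃ (N : ℕ) (p : Fin N → K[X]), p ≠ 0 ∧ ∑ i : Fin N, s ^ (i : ℕ) * aeval t (p i) = 0 := by
  have hs : IsAlgebraic (Algebra.adjoin K {t}) s :=
    (IsFractionRing.isAlgebraic_iff (Algebra.adjoin K {t}) K⟮t⟯ F).2
      (Algebra.IsAlgebraic.isAlgebraic s)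
  obtain ⟨q, hq0, hq⟩ := hs
  have hex : ∀ i : Fin (q.natDegree + 1), ∃ p : K[X], aeval t p = q.coeff i := fun i ↦ by
    obtain ⟨x, hx⟩ := q.coeff i
    rwa [Algebra.adjoin_singleton_eq_range_aeval] at hx
  choose p hp using hex
  refine ⟨_, p, fun h0 ↦ hq0 ?_, ?_⟩
  · rw [← leadingCoeff_eq_zero]
    have := hp (Fin.last _)
    rw [h0, Pi.zero_apply, map_zero] at this
    exact Subtype.ext this.symm
  · rw [aeval_eq_sum_range, ← Fin.sum_univ_eq_sum_range (fun i ↦ q.coeff i • s ^ i)] at hq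
    rw [← hq]
    refine Finset.sum_congr rfl fun i _ ↦ ?_
    rw [hp i, mul_comm]
    rfl

end AdjoinSimple

section Normalization

variable {R K A F L : Type*} [CommRing R] [IsDomain R] [IsDiscreteValuationRing R] [Field K]
  [Algebra R K] [IsFractionRing R K] [CommRing A] [IsDomain A] [IsDiscreteValuationRing A]
  [Field F] [Field L] [Algebra R A] [Algebra A F] [IsFractionRing A F] [Algebra K F] [Algebra R F]
  [IsScalarTower R A F] [IsScalarTower R K F] [Algebra (IsLocalRing.ResidueField R) L]

omit [IsDiscreteValuationRing A] in
/-- Powers of an element whose reduction is transcendental are independent modulo every power of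
the uniformizer. -/
lemma pow_dvd_of_pow_dvd_sum_pow_mul (ρ : A →+* L)
    (hρ : ∀ r : R, ρ (algebraMap R A r) = algebraMap _ L (IsLocalRing.residue R r))
    {π : R} (hπ : Irreducible π) (hπA : algebraMap R A π ≠ 0) (hπL : ρ (algebraMap R A π) = 0)
    {s : A} (hs : Transcendental (IsLocalRing.ResidueField R) (ρ s)) {N : ℕ} (n : ℕ) :
    ∀ c : Fin N → R, algebraMap R A π ^ n ∣ ∑ i : Fin N, s ^ (i : ℕ) * algebraMap R A (c i) →
      ∀ i, π ^ n ∣ c i := by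
  induction n with
  | zero => simp
  | succ n ih =>
    intro c hc
    have h1 : ∀ i, π ∣ c i := by
      have h2 : aeval (ρ s) (∑ i : Fin N, monomial i (IsLocalRing.residue R (c i))) = 0 := by
        obtain ⟨a, ha⟩ := (dvd_pow_self (algebraMap R A π) n.succ_ne_zero).trans hc
        have h3 := congrArg ρ ha
        rw [map_mul, hπL, zero_mul, map_sum] at h3
        rw [← h3, map_sum]
        refine Finset.sum_congr rfl fun i _ ↦ ?_
        rw [aeval_monomial, map_mul, map_pow, hρ, mul_comm]
      have h4 := (transcendental_iff.1 hs) _ h2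
      intro i
      have h5 := congrArg (fun q ↦ coeff q i) h4
      simp only [finsetSum_coeff, coeff_monomial, Fin.val_inj, Finset.sum_ite_eq',
        Finset.mem_univ, if_true, coeff_zero, IsLocalRing.residue_eq_zero_iff] at h5
      rwa [hπ.maximalIdeal_eq, Ideal.mem_span_singleton] at h5
    choose d hd using h1
    intro i
    rw [hd i, pow_succ']
    refine mul_dvd_mul_left π (ih d ?_ i)
    rw [← mul_dvd_mul_iff_left hπA, ← pow_succ', Finset.mul_sum]
    convert hc using 2 with i
    rw [hd i, map_mul]
    ring

/-- Given a discrete valuation ring `A` of `F` whose residue field is transcendental over that of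
`R`, every `t` over which `F` is algebraic can be replaced by a generator of `K(t)` lying in `A`
with nonconstant reduction. -/
lemma exists_adjoin_eq_and_residue_notMem_range (ρ : A →+* L)
    (hρ : ∀ r : R, ρ (algebraMap R A r) = algebraMap _ L (IsLocalRing.residue R r))
    {π : R} (hπ : Irreducible π) (hπA : Irreducible (algebraMap R A π))
    (hker : ∀ a, ρ a = 0 ↔ algebraMap R A π ∣ a)
    {s : A} (hs : Transcendental (IsLocalRing.ResidueField R) (ρ s))
    (t : F) (ht : Transcendental K t) [Algebra.IsAlgebraic (IntermediateField.adjoin K {t}) F] :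
    ∃ b : A, IntermediateField.adjoin K {algebraMap A F b} = IntermediateField.adjoin K {t} ∧
      ρ b ∉ Set.range (algebraMap (IsLocalRing.ResidueField R) L) := by
  by_contra! hcon
  have hπK : algebraMap R K π ≠ 0 := by
    simpa using hπ.ne_zero
  have hpow : ∀ n : ℕ, algebraMap K F (algebraMap R K π ^ n) = algebraMap A F (algebraMap R A π ^ n) := by
    intro n
    rw [map_pow, map_pow, ← IsScalarTower.algebraMap_apply, ← IsScalarTower.algebraMap_apply]
  obtain ⟨b, hb⟩ : ∃ b : A, IntermediateField.adjoin K {algebraMap A F b} =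
      IntermediateField.adjoin K {t} := by
    obtain ⟨x, y, hy, rfl⟩ := IsFractionRing.div_surjective (A := A) t
    obtain ⟨n, u, hu⟩ := IsDiscreteValuationRing.associated_pow_irreducible
      (nonZeroDivisors.ne_zero hy) hπA
    refine ⟨x * u, ?_⟩
    have h1 : algebraMap A F (x * u) =
        algebraMap K F (algebraMap R K π ^ n) * (algebraMap A F x / algebraMap A F y) := by
      have hy0 : algebraMap A F y ≠ 0 := by simpa using nonZeroDivisors.ne_zero hy
      rw [hpow, ← hu, map_mul, map_mul]
      field_simp
    rw [h1]
    exact adjoin_simple_algebraMap_mul (pow_ne_zero _ hπK) _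
  have hbt : Transcendental K (algebraMap A F b) := by
    intro hb'
    apply ht
    have := IntermediateField.isAlgebraic_adjoin_simple hb'.isIntegral
    rw [hb] at this
    exact (isAlgebraic_algebraMap_iff (algebraMap (IntermediateField.adjoin K {t}) F).injective).2
      (Algebra.IsAlgebraic.isAlgebraic (R := K) (IntermediateField.AdjoinSimple.gen K t))
  have happrox : ∀ n : ℕ, ∃ (r : R) (a : A), b = algebraMap R A r + algebraMap R A π ^ n * a ∧
      IntermediateField.adjoin K {algebraMap A F a} = IntermediateField.adjoin K {t} := by
    intro n
    induction n with
    | zero => exact ⟨0, b, by simp, hb⟩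
    | succ n ih =>
      obtain ⟨r, a, hra, hat⟩ := ih
      obtain ⟨c, hc⟩ := hcon a hat
      obtain ⟨r', rfl⟩ := IsLocalRing.residue_surjective c
      obtain ⟨a', ha'⟩ := (hker (a - algebraMap R A r')).1 (by rw [map_sub, hρ, hc, sub_self])
      refine ⟨r + π ^ n * r', a', ?_, ?_⟩
      · rw [hra, eq_add_of_sub_eq ha']
        simp only [map_add, map_mul, map_pow]
        ring
      · rw [← hat, ← adjoin_simple_sub_algebraMap (algebraMap R K r') (algebraMap A F a),
          ← adjoin_simple_algebraMap_mul hπK (algebraMap A F a')]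
        congr 2
        rw [← IsScalarTower.algebraMap_apply R K F, ← IsScalarTower.algebraMap_apply R K F,
          IsScalarTower.algebraMap_apply R A F, IsScalarTower.algebraMap_apply R A F,
          ← map_mul, ← ha', map_sub]
  have halg : Algebra.IsAlgebraic (IntermediateField.adjoin K {algebraMap A F b}) F := by
    rw [hb]; infer_instance
  obtain ⟨N, p, hp0, hp⟩ := exists_sum_range_pow_mul_aeval_eq_zero (K := K) (algebraMap A F b)
    (algebraMap A F s)
  obtain ⟨c, P, hc, hP, i₀, hi₀⟩ := exists_eq_C_mul_map_of_ne_zero (R := R) p hp0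
  have hsum : ∑ i : Fin N, s ^ (i : ℕ) * aeval b (P i) = 0 := by
    apply IsFractionRing.injective A F
    have h2 : algebraMap K F c * algebraMap A F (∑ i : Fin N, s ^ (i : ℕ) * aeval b (P i)) = 0 := by
      rw [← hp, map_sum, Finset.mul_sum]
      refine Finset.sum_congr rfl fun i _ ↦ ?_
      simp only [hP i, map_mul, aeval_C, aeval_algebraMap_map, map_pow]
      ring
    simpa using (mul_eq_zero.1 h2).resolve_left (by simpa using hc)
  have hdvd : ∀ n : ℕ, algebraMap R A π ^ n ∣ aeval b (P i₀) := by
    intro n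
    obtain ⟨r, a, hra, -⟩ := happrox n
    have hd : ∀ i, algebraMap R A π ^ n ∣ aeval b (P i) - algebraMap R A ((P i).eval r) := by
      intro i
      have h1 := sub_dvd_eval_sub b (algebraMap R A r) ((P i).map (algebraMap R A))
      rw [eval_map_algebraMap, eval_map_algebraMap, aeval_algebraMap_apply_eq_algebraMap_eval]
        at h1
      refine (Dvd.intro a ?_).trans h1
      rw [hra]; ring
    have h1 := pow_dvd_of_pow_dvd_sum_pow_mul ρ hρ hπ hπA.ne_zero ((hker _).2 dvd_rfl) hs n
      (fun i ↦ (P i).eval r) (by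
        have h2 : ∑ i : Fin N, s ^ (i : ℕ) * algebraMap R A ((P i).eval r) =
            - ∑ i : Fin N, s ^ (i : ℕ) * (aeval b (P i) - algebraMap R A ((P i).eval r)) := by
          simp only [mul_sub, Finset.sum_sub_distrib, hsum]
          ring
        rw [h2, dvd_neg]
        exact Finset.dvd_sum fun i _ ↦ (hd i).mul_left _) i₀
    have h3 := (algebraMap R A).map_dvd h1
    rw [map_pow] at h3
    simpa using dvd_add (hd i₀) h3
  have h0 : aeval b (P i₀) = 0 := by
    have h1 : aeval b (P i₀) ∈ ⨅ n : ℕ, Ideal.span {algebraMap R A π} ^ n := by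
      simp only [Ideal.mem_iInf, Ideal.span_singleton_pow, Ideal.mem_span_singleton]
      exact hdvd
    rwa [Ideal.iInf_pow_eq_bot_of_isDomain _ (by
      rw [Ne, Ideal.span_singleton_eq_top]; exact hπA.not_isUnit)] at h1
  have h1 : (P i₀).map (algebraMap R K) = 0 := by
    refine (transcendental_iff.1 hbt) _ ?_
    rw [aeval_algebraMap_map, h0, map_zero]
  rw [Polynomial.map_eq_zero_iff (IsFractionRing.injective R K)] at h1
  exact hi₀ (by rw [h1, Polynomial.map_zero])

/-- The number of rational places of the residue field of a discrete valuation ring of `F` is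
bounded in terms of the degree of `F` over a rational subfield. -/
theorem card_le_mul_finrank_adjoin {ι : Type*} [Finite ι] (ρ : A →+* L)
    (hρs : Function.Surjective ρ)
    (hρ : ∀ r : R, ρ (algebraMap R A r) = algebraMap _ L (IsLocalRing.residue R r))
    {π : R} (hπ : Irreducible π) (hπA : Irreducible (algebraMap R A π))
    (hker : ∀ a, ρ a = 0 ↔ algebraMap R A π ∣ a) [Finite (IsLocalRing.ResidueField R)]
    {s : L} (hs : Transcendental (IsLocalRing.ResidueField R) s)
    (t : F) (ht : Transcendental K t) [FiniteDimensional (IntermediateField.adjoin K {t}) F]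
    (V : ι → ValuationSubring L) [∀ i, IsDiscreteValuationRing (V i)] (hV : Function.Injective V)
    (hk : ∀ i c, algebraMap (IsLocalRing.ResidueField R) L c ∈ V i)
    (hVk : ∀ i, ∀ x ∈ V i, ∃ c : IsLocalRing.ResidueField R,
      (V i).valuation (x - algebraMap _ L c) < 1) :
    Nat.card ι ≤ (Nat.card (IsLocalRing.ResidueField R) + 1) *
      Module.finrank (IntermediateField.adjoin K {t}) F := by
  classical
  cases nonempty_fintype ι
  cases nonempty_fintype (IsLocalRing.ResidueField R)
  obtain ⟨s, rfl⟩ := hρs s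
  obtain ⟨b, hbt, hb⟩ := exists_adjoin_eq_and_residue_notMem_range ρ hρ hπ hπA hker hs t ht
  have hcase : ∀ i, ∃ c : Option (IsLocalRing.ResidueField R),
      (∀ r, c = some r → (V i).valuation (ρ b - algebraMap _ L r) < 1) ∧
      (c = none → (V i).valuation (ρ b)⁻¹ < 1) := by
    intro i
    by_cases h : ρ b ∈ V i
    · obtain ⟨c, hc⟩ := hVk i _ h
      exact ⟨some c, by simp [hc], by simp⟩
    · refine ⟨none, by simp, fun _ ↦ ?_⟩
      rw [← ValuationSubring.valuation_le_one_iff, not_le] at h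
      rw [map_inv₀]
      exact inv_lt_one_of_one_lt₀ h
  choose f hf hf' using hcase
  have hfib : ∀ c, (Finset.univ.filter fun i ↦ f i = c).card ≤
      Module.finrank (IntermediateField.adjoin K {t}) F := by
    intro c
    obtain ⟨u, hut, hu0, hu⟩ : ∃ u : A, IntermediateField.adjoin K {algebraMap A F u} =
        IntermediateField.adjoin K {t} ∧ ρ u ≠ 0 ∧
        ∀ i, f i = c → (V i).valuation (ρ u) < 1 := by
      cases c with
      | some r =>
        obtain ⟨r, rfl⟩ := IsLocalRing.residue_surjective r
        refine ⟨b - algebraMap R A r, ?_, ?_, ?_⟩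
        · rw [← hbt, ← adjoin_simple_sub_algebraMap (algebraMap R K r) (algebraMap A F b), map_sub,
            ← IsScalarTower.algebraMap_apply R K F, ← IsScalarTower.algebraMap_apply R A F]
        · rw [map_sub, hρ, Ne, sub_eq_zero]
          exact fun h ↦ hb ⟨_, h.symm⟩
        · intro i hi
          rw [map_sub, hρ]
          exact hf i _ hi
      | none =>
        have hub : IsUnit b := by
          by_contra h
          rw [← mem_nonunits_iff, ← IsLocalRing.mem_maximalIdeal, hπA.maximalIdeal_eq,
            Ideal.mem_span_singleton, ← hker] at h
          exact hb ⟨0, by rw [h, map_zero]⟩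
        obtain ⟨w, rfl⟩ := hub
        have h1 : ρ (↑w⁻¹ : A) = (ρ w)⁻¹ := by
          rw [← mul_eq_one_iff_eq_inv₀ (w.isUnit.map ρ).ne_zero, ← map_mul, Units.inv_mul, map_one]
        have h2 : algebraMap A F (↑w⁻¹ : A) = (algebraMap A F w)⁻¹ := by
          rw [← mul_eq_one_iff_eq_inv₀ (w.isUnit.map _).ne_zero, ← map_mul, Units.inv_mul, map_one]
        refine ⟨(w⁻¹ : Aˣ), ?_, (Units.isUnit _).map ρ |>.ne_zero, ?_⟩
        · rw [h2, adjoin_simple_inv, hbt]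
        · intro i hi
          rw [h1]
          exact hf' i hi
    let V' : {i // f i = c} → ValuationSubring L := fun i ↦ V i
    have (i : _) : IsDiscreteValuationRing (V' i) := inferInstanceAs (IsDiscreteValuationRing (V i))
    obtain ⟨x, hx⟩ := exists_sub_ite_valuation_lt_one V'
      (hV.comp Subtype.val_injective)
    choose a ha using fun i ↦ hρs (x i)
    have hfin : FiniteDimensional (IntermediateField.adjoin K {algebraMap A F u}) F := by
      rw [hut]; infer_instance
    have hcard := card_le_finrank_adjoin_simple (K := K) (algebraMap A F u)
      (fun i ↦ algebraMap A F (a i)) fun p hp ↦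
        eq_zero_of_sum_aeval_mul_eq_zero_of_residue ρ hρ u a
          (fun q hq ↦ eq_zero_of_sum_aeval_mul_eq_zero V' (fun i c ↦ hk i c) hu0
            (fun i ↦ hu i i.2) x hx q (by simpa only [ha] using hq)) p hp
    rw [hut, Fintype.card_subtype] at hcard
    exact hcard
  rw [Nat.card_eq_fintype_card, Nat.card_eq_fintype_card, ← Fintype.card_option, ← Finset.card_univ,
    mul_comm]
  exact Finset.card_le_mul_card_image_of_maps_to (t := Finset.univ) (f := f) (by simp) _
    fun c _ ↦ hfib c

end Normalization

end CurveTower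

namespace CurveTower

open Polynomial

section LocalRing

variable {R : Type*} [CommRing R] [IsLocalRing R] [IsNoetherianRing R]

open IsLocalRing in
/-- A Noetherian local ring whose maximal ideal is generated by a nonzerodivisor is a domain. -/
lemma isDomain_of_maximalIdeal_eq_span_singleton {a : R} (ha : a ∈ nonZeroDivisors R)
    (hm : maximalIdeal R = Ideal.span {a}) : IsDomain R := by
  have hne : Ideal.span {a} ≠ ⊤ := hm ▸ (maximalIdeal.isMaximal R).ne_top
  have hfac : ∀ x : R, x ≠ 0 → ∃ (n : ℕ) (u : Rˣ), x = a ^ n * u := by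
    intro x hx
    obtain ⟨n, hn⟩ : ∃ n : ℕ, ¬ a ^ n ∣ x := by
      by_contra! h
      refine hx ?_
      have : x ∈ ⨅ n : ℕ, Ideal.span {a} ^ n := by
        simpa only [Ideal.mem_iInf, Ideal.span_singleton_pow, Ideal.mem_span_singleton] using h
      rwa [Ideal.iInf_pow_eq_bot_of_isLocalRing _ hne] at this
    have hfin : FiniteMultiplicity a x := ⟨n, fun h ↦ hn ((pow_dvd_pow a n.le_succ).trans h)⟩
    obtain ⟨c, hc, hc'⟩ := hfin.exists_eq_pow_mul_and_not_dvd
    have hu : IsUnit c := by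
      by_contra h
      rw [← mem_nonunits_iff, ← mem_maximalIdeal, hm, Ideal.mem_span_singleton] at h
      exact hc' h
    exact ⟨_, hu.unit, hc⟩
  have : NoZeroDivisors R := ⟨fun {x y} hxy ↦ by
    by_contra! h
    obtain ⟨n, u, rfl⟩ := hfac x h.1
    obtain ⟨m, v, rfl⟩ := hfac y h.2
    have h1 : (↑(u * v) : R) * (a ^ n * a ^ m) = 0 := by
      rw [← hxy, Units.val_mul]; ring
    rw [Units.mul_right_eq_zero, ← pow_add] at h1
    exact nonZeroDivisors.ne_zero (pow_mem ha _) h1⟩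
  exact NoZeroDivisors.to_isDomain R

open IsLocalRing in
lemma isDiscreteValuationRing_of_maximalIdeal_eq_span_singleton [IsDomain R] {a : R} (ha : a ≠ 0)
    (hm : maximalIdeal R = Ideal.span {a}) : IsDiscreteValuationRing R := by
  have hf : ¬ IsField R := fun h ↦ by
    rw [isField_iff_maximalIdeal_eq, hm, Ideal.span_singleton_eq_bot] at h
    exact ha h
  exact ((IsDiscreteValuationRing.TFAE R hf).out 4 0 rfl rfl).1 ⟨a, hm⟩

end LocalRing

section Etale

variable {P S : Type*} [CommRing P] [IsPrincipalIdealRing P] [CommRing S] [Algebra P S]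
  [Algebra.Etale P S] (q : Ideal S) [q.IsPrime]

attribute [local instance] Localization.AtPrime.algebraOfLiesOver in
lemma exists_maximalIdeal_localization_eq_span_singleton :
    ∃ a : P, (q.under P = Ideal.span {a}) ∧
      IsLocalRing.maximalIdeal (Localization.AtPrime q) =
        Ideal.span {algebraMap P (Localization.AtPrime q) a} := by
  obtain ⟨a, ha⟩ := (IsPrincipalIdealRing.principal (q.under P)).principal
  refine ⟨a, ha, ?_⟩
  have h := ((Algebra.isUnramifiedAt_iff_map_eq P (q.under P) q).1 inferInstance).2
  have ha' : q.under P = Ideal.span {a} := ha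
  rw [← h, ha', Ideal.map_span, Set.image_singleton]

lemma algebraMap_localization_mem_nonZeroDivisors {P S : Type*} [CommRing P] [IsDomain P]
    [CommRing S] [Algebra P S] [Algebra.Etale P S] (q : Ideal S) [q.IsPrime] {a : P} (ha : a ≠ 0) :
    algebraMap P (Localization.AtPrime q) a ∈ nonZeroDivisors (Localization.AtPrime q) := by
  have : Module.Flat P S := Algebra.Smooth.flat P S
  have : Module.Flat P (Localization.AtPrime q) := Module.Flat.trans P S _
  have hreg : IsSMulRegular P a := fun x y h ↦ mul_left_cancel₀ ha h
  rw [mem_nonZeroDivisors_iff_left]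
  intro x hx
  exact hreg.of_flat (S := Localization.AtPrime q) (by simpa using hx)

/-- The local rings of an étale algebra over a principal ideal domain are domains. -/
lemma isDomain_localization_of_etale (P : Type*) {S : Type*} [CommRing P] [IsDomain P]
    [IsPrincipalIdealRing P] [CommRing S] [Algebra P S] [Algebra.Etale P S] (q : Ideal S)
    [q.IsPrime] [IsNoetherianRing S] : IsDomain (Localization.AtPrime q) := by
  obtain ⟨a, -, ha⟩ := exists_maximalIdeal_localization_eq_span_singleton (P := P) q
  rcases eq_or_ne a 0 with rfl | h0
  · rw [map_zero, Ideal.span_singleton_eq_bot.2 rfl, ← IsLocalRing.isField_iff_maximalIdeal_eq] at ha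
    exact ha.isDomain
  · exact isDomain_of_maximalIdeal_eq_span_singleton
      (algebraMap_localization_mem_nonZeroDivisors q h0) ha

lemma isDiscreteValuationRing_localization_of_etale [IsDomain P] [IsNoetherianRing S]
    [IsDomain (Localization.AtPrime q)] (hq : q.under P ≠ ⊥) :
    IsDiscreteValuationRing (Localization.AtPrime q) := by
  obtain ⟨a, ha', ha⟩ := exists_maximalIdeal_localization_eq_span_singleton (P := P) q
  have h0 : a ≠ 0 := by
    rintro rfl
    exact hq (by rw [ha', Ideal.span_singleton_eq_bot])
  exact isDiscreteValuationRing_of_maximalIdeal_eq_span_singleton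
    (nonZeroDivisors.ne_zero (algebraMap_localization_mem_nonZeroDivisors q h0)) ha

end Etale

section FunctionField

lemma algebraMap_polynomial_injective_of_etale (k S F : Type*) [Field k] [CommRing S] [IsDomain S]
    [Algebra k[X] S] [Algebra.Etale k[X] S] [Field F] [Algebra S F] [IsFractionRing S F]
    [Algebra k[X] F] [IsScalarTower k[X] S F] :
    Function.Injective (algebraMap k[X] F) := by
  have : Module.Flat k[X] S := Algebra.Smooth.flat k[X] S
  rw [IsScalarTower.algebraMap_eq k[X] S F]
  refine (IsFractionRing.injective S F).comp ?_
  rw [injective_iff_map_eq_zero]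
  intro p hp
  by_contra hp0
  have hreg : IsSMulRegular k[X] p := fun x y h ↦ mul_left_cancel₀ hp0 h
  exact one_ne_zero (α := S) (hreg.of_flat (S := S) (by simp [hp]))

/-- The fraction field of an étale `k[X]`-algebra is finite over `k(t)` for every transcendental
element `t`. -/
lemma finiteDimensional_adjoin_simple_of_etale (k S F : Type*) [Field k] [CommRing S] [IsDomain S]
    [Algebra k[X] S] [Algebra.Etale k[X] S] [Field F] [Algebra S F] [IsFractionRing S F]
    [Algebra k[X] F] [IsScalarTower k[X] S F] [Algebra k F] [IsScalarTower k k[X] F]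
    (t : F) (ht : Transcendental k t) :
    FiniteDimensional (IntermediateField.adjoin k {t}) F := by
  have hinj := algebraMap_polynomial_injective_of_etale k S F
  have : FaithfulSMul k[X] F := (faithfulSMul_iff_algebraMap_injective _ _).2 hinj
  let := FractionRing.liftAlgebra k[X] F
  have hess : Algebra.EssFiniteType S F := Algebra.EssFiniteType.of_isLocalization F (nonZeroDivisors S)
  have hess' : Algebra.EssFiniteType k[X] F := Algebra.EssFiniteType.comp k[X] S F
  have : Algebra.EssFiniteType (FractionRing k[X]) F := .of_comp k[X] _ _
  have : Algebra.FormallyUnramified S F :=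
    Algebra.FormallyUnramified.of_isLocalization (nonZeroDivisors S)
  have : Algebra.FormallyUnramified k[X] F := Algebra.FormallyUnramified.comp k[X] S F
  have : Algebra.FormallyUnramified (FractionRing k[X]) F := .of_restrictScalars k[X] _ _
  have : Module.Finite (FractionRing k[X]) F :=
    Algebra.FormallyUnramified.finite_of_free _ _
  have : Algebra.IsAlgebraic k[X] F :=
    (IsFractionRing.comap_isAlgebraic_iff (K := FractionRing k[X])).2 inferInstance
  have htr : Algebra.trdeg k F ≤ 1 := by
    have h := lift_trdeg_add_eq k k[X] F
    rw [Polynomial.trdeg_of_isDomain, trdeg_eq_zero (R := k[X]) (A := F), Cardinal.lift_one,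
      Cardinal.lift_zero, add_zero] at h
    rw [← Cardinal.lift_le, ← h, Cardinal.lift_one]
  have hess'' : Algebra.EssFiniteType k F := Algebra.EssFiniteType.comp k k[X] F
  have hai : AlgebraicIndependent k (fun _ : Unit ↦ t) :=
    (algebraicIndependent_unique_type_iff).2 ht
  have hb : IsTranscendenceBasis k (fun _ : Unit ↦ t) :=
    hai.isTranscendenceBasis_of_lift_trdeg_le_of_finite (by simpa using htr)
  have halg := hb.isAlgebraic_field
  rw [Set.range_const] at halg
  have : Algebra.EssFiniteType (IntermediateField.adjoin k {t}) F := .of_comp k _ _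
  exact Algebra.finite_of_essFiniteType_of_isAlgebraic
end FunctionField

end CurveTower

namespace CurveTower

open Polynomial

/-- A connected space covered by irreducible open sets is irreducible. -/
lemma irreducibleSpace_of_forall_exists_isOpen {X : Type*} [TopologicalSpace X] [ConnectedSpace X]
    (h : ∀ x : X, ∃ U : Set X, IsOpen U ∧ x ∈ U ∧ IsPreirreducible U) : IrreducibleSpace X := by
  have hdense : ∀ U : Set X, IsOpen U → U.Nonempty → closure U = Set.univ := by
    intro U hU hne
    refine IsClopen.eq_univ ⟨isClosed_closure, isOpen_iff_forall_mem_open.2 fun x hx ↦ ?_⟩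
      hne.closure
    obtain ⟨N, hN, hxN, hirr⟩ := h x
    refine ⟨N, ?_, hN, hxN⟩
    intro y hy
    rw [mem_closure_iff]
    intro W hW hyW
    obtain ⟨z, hzN, hzU⟩ := mem_closure_iff.1 hx N hN hxN
    obtain ⟨w, -, hwW, hwU⟩ := hirr W U hW hU ⟨y, hy, hyW⟩ ⟨z, hzN, hzU⟩
    exact ⟨w, hwW, hwU⟩
  have : PreirreducibleSpace X := ⟨fun U V hU hV ⟨x, _, hx⟩ ⟨y, _, hy⟩ ↦ by
    have hmem : x ∈ closure V := by rw [hdense V hV ⟨y, hy⟩]; trivial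
    obtain ⟨z, hz⟩ := mem_closure_iff.1 hmem U hU hx
    exact ⟨z, trivial, hz⟩⟩
  exact { toNonempty := inferInstance }

section Smooth

variable {k : Type u} [Field k] {C : Scheme.{u}} (f : C ⟶ Spec (.of k))

/-- A smooth curve is locally étale over the affine line. -/
lemma exists_etale_chart [SmoothOfRelativeDimension 1 f] (x : C) :
    ∃ (S : CommRingCat.{u}) (j : Spec S ⟶ C) (_ : IsOpenImmersion j) (g : k[X] →+* S),
      g.Etale ∧ x ∈ Set.range j ∧
      Spec.map (CommRingCat.ofHom (g.comp Polynomial.C)) = j ≫ f := by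
  obtain ⟨U, hU, V, hV, hx, e, hs⟩ :=
    SmoothOfRelativeDimension.exists_isStandardSmoothOfRelativeDimension (n := 1) (f := f) x
  obtain rfl : U = ⊤ := by
    refine top_le_iff.1 fun y _ ↦ ?_
    rw [Subsingleton.elim y (f x)]
    exact e hx
  have h1 : RingHom.IsStandardSmoothOfRelativeDimension 1
      ((f.appLE ⊤ V e).hom.comp (Scheme.ΓSpecIso (.of k)).symm.commRingCatIsoToRingEquiv.toRingHom) :=
    RingHom.isStandardSmoothOfRelativeDimension_respectsIso.2 _ _ hs
  obtain ⟨g, hg, hgE⟩ := h1.exists_etale_mvPolynomial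
  let E := (MvPolynomial.uniqueAlgEquiv k (Fin 1)).symm
  have hgE' : (g.comp E.toRingEquiv.toRingHom).Etale := RingHom.Etale.respectsIso.2 g E.toRingEquiv hgE
  refine ⟨Γ(C, V), hV.fromSpec, inferInstance, _, hgE', by rwa [hV.range_fromSpec], ?_⟩
  have h2 : (g.comp E.toRingEquiv.toRingHom).comp Polynomial.C =
      ((Scheme.ΓSpecIso (.of k)).inv ≫ f.appLE ⊤ V e).hom := by
    have h3 : (E.toRingEquiv.toRingHom).comp Polynomial.C = MvPolynomial.C :=
      RingHom.ext fun r ↦ E.commutes r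
    rw [RingHom.comp_assoc, h3, hg]
    rfl
  rw [h2, CommRingCat.ofHom_hom, Spec.map_comp, ← Scheme.isoSpec_Spec_inv,
    ← IsAffineOpen.fromSpec_top]
  exact IsAffineOpen.SpecMap_appLE_fromSpec f (isAffineOpen_top _) hV e

/-- The local ring of a point of an affine chart is a localization of the coordinate ring. -/
lemma exists_isLocalization_stalk {S : CommRingCat.{u}} (j : Spec S ⟶ C) [IsOpenImmersion j]
    (x : Spec S) (q : Ideal S) [q.IsPrime] (hq : x.asIdeal = q) :
    ∃ φ : S ⟶ C.presheaf.stalk (j x), Spec.map φ ≫ j = C.fromSpecStalk (j x) ∧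
      @IsLocalization.AtPrime S _ (C.presheaf.stalk (j x)) _ φ.hom.toAlgebra q _ := by
  subst hq
  let φ₀ : S ⟶ (Spec S).presheaf.stalk x :=
    (Scheme.ΓSpecIso S).inv ≫ (Spec S).presheaf.germ ⊤ x trivial
  let e₁ : C.presheaf.stalk (j x) ≅ (Spec S).presheaf.stalk x := asIso (j.stalkMap x)
  let e₂ : (Spec S).presheaf.stalk x ≅ CommRingCat.of (Localization.AtPrime x.asIdeal) :=
    Spec.stalkIso S x
  have h : φ₀ ≫ e₂.hom = CommRingCat.ofHom (algebraMap S _) := by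
    have := Spec.germ_stalkMapIso_hom (R := S) x
    simp only [φ₀, e₂, Category.assoc]
    exact (Iso.inv_comp_eq _).2 this
  refine ⟨φ₀ ≫ e₁.inv, ?_, ?_⟩
  · rw [Spec.map_comp, Category.assoc, ← Spec.fromSpecStalk_eq,
      ← Scheme.SpecMap_stalkMap_fromSpecStalk, ← Spec.map_comp_assoc]
    simp [e₁]
  · let := (φ₀ ≫ e₁.inv).hom.toAlgebra
    let E : C.presheaf.stalk (j x) ≃ₐ[S] Localization.AtPrime x.asIdeal :=
      AlgEquiv.ofRingEquiv (f := (e₁ ≪≫ e₂).commRingCatIsoToRingEquiv) fun s ↦ by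
        have h' : (φ₀ ≫ e₁.inv) ≫ (e₁ ≪≫ e₂).hom = CommRingCat.ofHom (algebraMap S _) := by
          simp [h]
        exact congr($h' s)
    exact IsLocalization.isLocalization_of_algEquiv _ E.symm

lemma isDomain_stalk_of_smooth [SmoothOfRelativeDimension 1 f] (x : C) :
    IsDomain (C.presheaf.stalk x) := by
  obtain ⟨S, j, hj, g, hg, ⟨q, rfl⟩, -⟩ := exists_etale_chart f x
  algebraize [g]
  have : IsNoetherianRing S := Algebra.FiniteType.isNoetherianRing k[X] S
  have : (PrimeSpectrum.asIdeal q).IsPrime := q.2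
  obtain ⟨φ, -, hφ⟩ := exists_isLocalization_stalk j q (PrimeSpectrum.asIdeal q) rfl
  have := isDomain_localization_of_etale k[X] (PrimeSpectrum.asIdeal q)
  let := φ.hom.toAlgebra
  exact (IsLocalization.algEquiv (PrimeSpectrum.asIdeal q).primeCompl (C.presheaf.stalk (j q))
    (Localization.AtPrime (PrimeSpectrum.asIdeal q))).toMulEquiv.isDomain _

lemma isIntegral_of_smooth [SmoothOfRelativeDimension 1 f] [GeometricallyConnected f] :
    IsIntegral C := by
  have : Smooth f := SmoothOfRelativeDimension.smooth 1 f
  have : IsLocallyNoetherian C := LocallyOfFiniteType.isLocallyNoetherian f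
  have : ConnectedSpace C := GeometricallyConnected.connectedSpace_of_subsingleton f
  have hdom (x : C) : IsDomain (C.presheaf.stalk x) := isDomain_stalk_of_smooth f x
  have : IsReduced C := isReduced_of_isReduced_stalk C
  have : IrreducibleSpace C := by
    refine irreducibleSpace_of_forall_exists_isOpen fun x ↦ ?_
    obtain ⟨U, hx, hU, hinj⟩ := C.exists_germ_injective x
    refine ⟨U, U.isOpen, hx, ?_⟩
    have : IsDomain Γ(C, U) := Function.Injective.isDomain (C.presheaf.germ U x hx).hom hinj
    rw [← hU.range_fromSpec, ← Set.image_univ]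
    exact (PreirreducibleSpace.isPreirreducible_univ).image _ hU.fromSpec.continuous.continuousOn
  exact isIntegral_of_irreducibleSpace_of_isReduced C

end Smooth

end CurveTower

namespace CurveTower

open Polynomial IsLocalRing

section ScalarMap

variable {k : Type u} [CommRing k] {X : Scheme.{u}} (f : X ⟶ Spec (.of k))

/-- The structure map from the base ring to the local ring of a point. -/
noncomputable def scalarToStalk (x : X) : CommRingCat.of k ⟶ X.presheaf.stalk x :=
  Spec.preimage (X.fromSpecStalk x ≫ f)

lemma specMap_scalarToStalk (x : X) :
    Spec.map (scalarToStalk f x) = X.fromSpecStalk x ≫ f :=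
  Spec.map_preimage _

lemma eq_scalarToStalk {x : X} {φ : CommRingCat.of k ⟶ X.presheaf.stalk x}
    (h : Spec.map φ = X.fromSpecStalk x ≫ f) : φ = scalarToStalk f x :=
  Spec.map_injective (h.trans (specMap_scalarToStalk f x).symm)

/-- The function field of an integral scheme over a ring as an algebra over that ring. -/
noncomputable abbrev functionFieldAlgebra [IsIntegral X] : Algebra k X.functionField :=
  (scalarToStalk f (genericPoint X)).hom.toAlgebra

/-- The function field is the fraction field of the coordinate ring of any nonempty affine chart. -/
lemma exists_isFractionRing_functionField [IsIntegral X] {S : CommRingCat.{u}} (j : Spec S ⟶ X)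
    [IsOpenImmersion j] [Nonempty (Spec S)] :
    IsDomain S ∧ ∃ φ : S ⟶ X.functionField, Spec.map φ ≫ j = X.fromSpecStalk (genericPoint X) ∧
      @IsFractionRing S _ X.functionField _ φ.hom.toAlgebra := by
  have : IsIntegral (Spec S) := isIntegral_of_isOpenImmersion j
  have hS : IsDomain S := (affine_isIntegral_iff S).1 inferInstance
  refine ⟨hS, ?_⟩
  have key : ∀ y : X, j (genericPoint (Spec S)) = y → ∃ φ : S ⟶ X.presheaf.stalk y,
      Spec.map φ ≫ j = X.fromSpecStalk y ∧
      @IsFractionRing S _ (X.presheaf.stalk y) _ φ.hom.toAlgebra := by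
    rintro _ rfl
    obtain ⟨φ, h1, h2⟩ := exists_isLocalization_stalk j (genericPoint (Spec S)) ⊥ (by
      rw [genericPoint_eq_bot_of_affine]; rfl)
    refine ⟨φ, h1, ?_⟩
    let := φ.hom.toAlgebra
    have h3 : (⊥ : Ideal S).primeCompl = nonZeroDivisors S := by
      ext x
      simp [Ideal.primeCompl]
    change IsLocalization (nonZeroDivisors S) _
    rw [← h3]
    exact h2
  exact key _ (genericPoint_eq_of_isOpenImmersion j)

end ScalarMap

section Curve

variable {k : Type u} [Field k] {X : Scheme.{u}} (f : X ⟶ Spec (.of k))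

/-- The function field of a smooth curve is a separating extension of a rational function field. -/
lemma exists_etale_functionField [SmoothOfRelativeDimension 1 f] [IsIntegral X] :
    ∃ (S : CommRingCat.{u}) (_ : IsDomain S) (g : k[X] →+* S) (φ : S →+* X.functionField),
      g.Etale ∧ @IsFractionRing S _ X.functionField _ φ.toAlgebra ∧
      (φ.comp g).comp C = (scalarToStalk f (genericPoint X)).hom := by
  obtain ⟨S, j, hj, g, hg, ⟨x, hx⟩, hf⟩ := exists_etale_chart f (genericPoint X)
  have : Nonempty (Spec S) := ⟨x⟩
  obtain ⟨hS, φ, h1, h2⟩ := exists_isFractionRing_functionField j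
  refine ⟨S, hS, g, φ.hom, hg, h2, ?_⟩
  have h3 : CommRingCat.ofHom (g.comp C) ≫ φ = scalarToStalk f (genericPoint X) := by
    apply eq_scalarToStalk
    rw [Spec.map_comp, hf, ← Category.assoc, h1]
  exact congr(($h3).hom)

lemma exists_transcendental_functionField [SmoothOfRelativeDimension 1 f] [IsIntegral X] :
    letI := functionFieldAlgebra f
    ∃ s : X.functionField, Transcendental k s := by
  obtain ⟨S, hS, g, φ, hg, hφ, hs⟩ := exists_etale_functionField f
  let := functionFieldAlgebra f
  algebraize [g]
  let := φ.toAlgebra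
  let := (φ.comp g).toAlgebra
  have : IsScalarTower k[X] S X.functionField := .of_algebraMap_eq' rfl
  have hinj := algebraMap_polynomial_injective_of_etale k S X.functionField
  refine ⟨φ (g Polynomial.X), transcendental_iff_injective.2 ?_⟩
  have h : (aeval (R := k) (φ (g Polynomial.X))).toRingHom = φ.comp g := by
    ext
    · simp only [AlgHom.toRingHom_eq_coe, RingHom.coe_comp, RingHom.coe_coe, Function.comp_apply,
        aeval_C]
      exact congr($hs.symm _)
    · simp
  have h2 : Function.Injective (φ.comp g) := hinj
  rw [← h] at h2
  exact h2

lemma finiteDimensional_functionField [SmoothOfRelativeDimension 1 f] [IsIntegral X] :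
    letI := functionFieldAlgebra f
    ∀ t : X.functionField, Transcendental k t →
      FiniteDimensional (IntermediateField.adjoin k {t}) X.functionField := by
  obtain ⟨S, hS, g, φ, hg, hφ, hs⟩ := exists_etale_functionField f
  let := functionFieldAlgebra f
  intro t ht
  algebraize [g]
  let := φ.toAlgebra
  let := (φ.comp g).toAlgebra
  have : IsScalarTower k[X] S X.functionField := .of_algebraMap_eq' rfl
  have : IsScalarTower k k[X] X.functionField := .of_algebraMap_eq' hs.symm
  exact finiteDimensional_adjoin_simple_of_etale k S X.functionField t ht

end Curve

end CurveTower

namespace CurveTower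

open Polynomial IsLocalRing

lemma exists_valuationSubring_ringEquiv (A F : Type*) [CommRing A] [IsDomain A] [ValuationRing A]
    [Field F] [Algebra A F] [IsFractionRing A F] :
    ∃ (V : ValuationSubring F) (e : A ≃+* V), ∀ a, (e a : F) = algebraMap A F a := by
  let V : ValuationSubring F :=
    { (algebraMap A F).range with
      mem_or_inv_mem' := fun x ↦ ValuationRing.isInteger_or_isInteger A x }
  refine ⟨V, RingEquiv.ofBijective
    ((algebraMap A F).codRestrict V fun a ↦ ⟨a, rfl⟩) ⟨fun a b h ↦ ?_, ?_⟩, fun a ↦ rfl⟩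
  · exact IsFractionRing.injective A F congr(($h : F))
  · rintro ⟨_, a, rfl⟩
    exact ⟨a, rfl⟩

section RationalPoints

variable {k : Type u} [Field k] {X : Scheme.{u}} (f : X ⟶ Spec (.of k))

lemma isDiscreteValuationRing_stalk [SmoothOfRelativeDimension 1 f] [IsIntegral X] (x : X)
    (e : X.presheaf.stalk x →+* k) [IsLocalHom e]
    (he : e.comp (scalarToStalk f x).hom = RingHom.id k) :
    IsDiscreteValuationRing (X.presheaf.stalk x) := by
  obtain ⟨S, j, hj, g, hg, ⟨q, rfl⟩, hf⟩ := exists_etale_chart f x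
  have hq' : (PrimeSpectrum.asIdeal q).IsPrime := q.2
  obtain ⟨φ, h1, h2⟩ := exists_isLocalization_stalk j q (PrimeSpectrum.asIdeal q) rfl
  have h3 : CommRingCat.ofHom (g.comp C) ≫ φ = scalarToStalk f (j q) := by
    apply eq_scalarToStalk
    rw [Spec.map_comp, hf, ← Category.assoc, h1]
  have h4 : φ.hom.comp (g.comp C) = (scalarToStalk f (j q)).hom := congr(($h3).hom)
  algebraize [g]
  have : IsNoetherianRing S := Algebra.FiniteType.isNoetherianRing k[X] S
  let := φ.hom.toAlgebra
  let E := IsLocalization.algEquiv (PrimeSpectrum.asIdeal q).primeCompl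
    (Localization.AtPrime (PrimeSpectrum.asIdeal q)) (X.presheaf.stalk (j q))
  have := isDomain_localization_of_etale k[X] (PrimeSpectrum.asIdeal q)
  have : IsDiscreteValuationRing (Localization.AtPrime (PrimeSpectrum.asIdeal q)) := by
    refine isDiscreteValuationRing_localization_of_etale (P := k[X]) _ fun h0 ↦ ?_
    let a : k := e (φ (g Polynomial.X))
    have hmem : Polynomial.X - C a ∈ (PrimeSpectrum.asIdeal q).under k[X] := by
      by_contra hn
      have h5 : IsUnit (φ (g (Polynomial.X - C a))) :=
        IsLocalization.map_units (X.presheaf.stalk (j q))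
          (⟨g (Polynomial.X - C a), hn⟩ : (PrimeSpectrum.asIdeal q).primeCompl)
      have h6 : e (φ (g (Polynomial.X - C a))) = 0 := by
        have : e (φ (g (C a))) = a := by
          have := congr($he a)
          rw [← h4] at this
          exact this
        rw [map_sub, map_sub, map_sub, this, sub_self]
      exact (h5.map e).ne_zero h6
    rw [h0] at hmem
    exact X_sub_C_ne_zero a hmem
  exact IsDiscreteValuationRing.RingEquivClass.isDiscreteValuationRing E.toRingEquiv

/-- A rational point of a smooth curve determines a discrete valuation ring of the function
field, through which the point factors. -/
lemma exists_valuationSubring_of_section [SmoothOfRelativeDimension 1 f] [IsIntegral X]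
    (p : Spec (.of k) ⟶ X) (hp : p ≫ f = 𝟙 _) :
    ∃ (V : ValuationSubring X.functionField) (α : Spec (.of V) ⟶ X) (ε : V →+* k),
      IsDiscreteValuationRing V ∧ IsLocalHom ε ∧ p = Spec.map (CommRingCat.ofHom ε) ≫ α ∧
      Spec.map (CommRingCat.ofHom V.subtype) ≫ α = X.fromSpecStalk (genericPoint X) := by
  let x := p (closedPoint k)
  let e : X.presheaf.stalk x ⟶ CommRingCat.of k := Scheme.stalkClosedPointTo p
  have hloc : IsLocalHom e.hom := Scheme.isLocalHom_stalkClosedPointTo p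
  have hpe : Spec.map e ≫ X.fromSpecStalk x = p := Scheme.Spec_stalkClosedPointTo_fromSpecStalk p
  have he : scalarToStalk f x ≫ e = 𝟙 _ := by
    apply Spec.map_injective
    rw [Spec.map_comp, specMap_scalarToStalk, ← Category.assoc, hpe, hp, Spec.map_id]
  have := isDiscreteValuationRing_stalk f x e.hom congr(($he).hom)
  obtain ⟨V, E, hE⟩ := exists_valuationSubring_ringEquiv (X.presheaf.stalk x) X.functionField
  refine ⟨V, Spec.map (CommRingCat.ofHom E.toRingHom) ≫ X.fromSpecStalk x,
    e.hom.comp E.symm.toRingHom, IsDiscreteValuationRing.RingEquivClass.isDiscreteValuationRing E,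
    ⟨fun a ha ↦ ?_⟩, ?_, ?_⟩
  · have h1 : IsUnit (E.symm a) := isUnit_of_map_unit e.hom _ ha
    simpa using h1.map E
  · rw [← Category.assoc, ← Spec.map_comp]
    conv_lhs => rw [← hpe]
    congr 2
    ext a
    simp
  · rw [← Category.assoc, ← Spec.map_comp,
      ← X.SpecMap_stalkSpecializes_fromSpecStalk ((genericPoint_spec X).specializes trivial)]
    congr 2
    ext a
    exact hE a

/-- Distinct rational points of a separated smooth curve give distinct discrete valuation rings of
the function field, with residue field the base field. -/
lemma exists_valuationSubring_family [SmoothOfRelativeDimension 1 f] [IsIntegral X] [IsSeparated f]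
    {ι : Type*} (p : ι → (Spec (.of k) ⟶ X)) (hinj : Function.Injective p)
    (hp : ∀ i, p i ≫ f = 𝟙 _) :
    letI := functionFieldAlgebra f
    ∃ V : ι → ValuationSubring X.functionField, Function.Injective V ∧
      (∀ i, IsDiscreteValuationRing (V i)) ∧
      (∀ i (c : k), algebraMap k X.functionField c ∈ V i) ∧
      ∀ i, ∀ x ∈ V i, ∃ c : k, (V i).valuation (x - algebraMap k X.functionField c) < 1 := by
  let := functionFieldAlgebra f
  choose V α ε hV hε hpα hα using fun i ↦ exists_valuationSubring_of_section f (p i) (hp i)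
  have hσ (i : ι) : ∃ σ : k →+* V i, (V i).subtype.comp σ = algebraMap k X.functionField ∧
      (ε i).comp σ = RingHom.id k ∧ Spec.map (CommRingCat.ofHom σ) = α i ≫ f := by
    have h : Spec.map (Spec.preimage (α i ≫ f)) = α i ≫ f := Spec.map_preimage _
    refine ⟨(Spec.preimage (α i ≫ f)).hom, ?_, ?_, h⟩
    · have h1 : Spec.preimage (α i ≫ f) ≫ CommRingCat.ofHom (V i).subtype =
          scalarToStalk f (genericPoint X) := by
        apply eq_scalarToStalk
        rw [Spec.map_comp, h, ← Category.assoc, hα]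
      exact congr(($h1).hom)
    · have h1 : Spec.preimage (α i ≫ f) ≫ CommRingCat.ofHom (ε i) = 𝟙 _ := by
        apply Spec.map_injective
        rw [Spec.map_comp, h, ← Category.assoc, ← hpα, hp, Spec.map_id]
      exact congr(($h1).hom)
  choose σ hσ1 hσ2 hσ3 using hσ
  have hker (i : ι) (y : V i) : y - σ i (ε i y) ∈ maximalIdeal (V i) := by
    rw [mem_maximalIdeal, mem_nonunits_iff]
    intro hu
    refine (hu.map (ε i)).ne_zero ?_
    have : ε i (σ i (ε i y)) = ε i y := congr($(hσ2 i) _)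
    rw [map_sub, this, sub_self]
  refine ⟨V, fun a b hab ↦ hinj ?_, hV, fun i c ↦ ?_, fun i x hx ↦ ?_⟩
  · suffices key : ∀ (W W' : ValuationSubring X.functionField) (h : W = W')
        (α : Spec (.of W) ⟶ X) (α' : Spec (.of W') ⟶ X)
        (ε : W →+* k) (ε' : W' →+* k) (σ : k →+* W) (σ' : k →+* W'),
        (∀ y, y - σ (ε y) ∈ maximalIdeal W) →
        (∀ y, y - σ' (ε' y) ∈ maximalIdeal W') → IsLocalHom ε →
        W.subtype.comp σ = algebraMap k X.functionField →
        W'.subtype.comp σ' = algebraMap k X.functionField →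
        ε.comp σ = RingHom.id k →
        Spec.map (CommRingCat.ofHom σ) = α ≫ f → Spec.map (CommRingCat.ofHom σ') = α' ≫ f →
        Spec.map (CommRingCat.ofHom W.subtype) ≫ α = X.fromSpecStalk (genericPoint X) →
        Spec.map (CommRingCat.ofHom W'.subtype) ≫ α' = X.fromSpecStalk (genericPoint X) →
        Spec.map (CommRingCat.ofHom ε) ≫ α = Spec.map (CommRingCat.ofHom ε') ≫ α' by
      rw [hpα a, hpα b]
      exact key _ _ hab _ _ _ _ _ _ (hker a) (hker b) (hε a) (hσ1 a) (hσ1 b) (hσ2 a)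
        (hσ3 a) (hσ3 b) (hα a) (hα b)
    rintro W _ rfl α α' ε ε' σ σ' hker hker' hε hσ hσ' hεσ h1 h2 h3 h4
    obtain rfl : σ = σ' := by
      ext c
      exact congr($(hσ.trans hσ'.symm) c)
    have hεε : ε = ε' := by
      ext y
      have h5 : ε (y - σ (ε' y)) = 0 := by
        by_contra h0
        exact (mem_nonunits_iff.1 ((mem_maximalIdeal _).1 (hker' y)))
          (isUnit_of_map_unit ε _ (Ne.isUnit h0))
      have h6 : ε (σ (ε' y)) = ε' y := congr($hεσ _)
      rw [map_sub, h6, sub_eq_zero] at h5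
      exact h5
    rw [hεε]
    congr 1
    let sq : ValuativeCommSq f :=
      { R := W
        K := X.functionField
        i₁ := X.fromSpecStalk (genericPoint X)
        i₂ := Spec.map (CommRingCat.ofHom σ)
        commSq := ⟨by rw [h1, ← h3, Category.assoc]; rfl⟩ }
    have := IsSeparated.valuativeCriterion f sq
    let l : sq.commSq.LiftStruct := ⟨α, h3, h1.symm⟩
    let l' : sq.commSq.LiftStruct := ⟨α', h4, h2.symm⟩
    exact congr(($(Subsingleton.elim l l')).l)
  · rw [← hσ1 i]
    exact (σ i c).2
  · refine ⟨ε i ⟨x, hx⟩, ?_⟩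
    have h := ((V i).valuation_lt_one_iff _).1 (hker i ⟨x, hx⟩)
    rw [← hσ1 i]
    exact h

end RationalPoints

end CurveTower

namespace CurveTower

open Polynomial IsLocalRing

lemma exists_isLocalization_stalk_of_eq {Y : Scheme.{u}} {S : CommRingCat.{u}} (j : Spec S ⟶ Y)
    [IsOpenImmersion j] (z : Spec S) (q : Ideal S) [q.IsPrime] (hq : z.asIdeal = q) {y : Y}
    (hy : j z = y) :
    ∃ φ : S ⟶ Y.presheaf.stalk y, Spec.map φ ≫ j = Y.fromSpecStalk y ∧
      @IsLocalization.AtPrime S _ (Y.presheaf.stalk y) _ φ.hom.toAlgebra q _ := by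
  subst hy
  exact exists_isLocalization_stalk j z q hq

section Degree

variable {k : Type u} [Field k] {X Y : Scheme.{u}} (f : X ⟶ Y) (h : Y ⟶ Spec (.of k))

/-- The residue degree at the generic point of a morphism to a scheme which is locally a closed
subscheme of the affine line. -/
lemma exists_residueDegree_genericPoint_eq_finrank [IsIntegral X] {S : CommRingCat.{u}}
    (j : Spec S ⟶ Y) [IsOpenImmersion j] (z : Spec S) (hz : j z = f (genericPoint X))
    (g : k[X] →+* S) (hg : Function.Surjective g)
    (hgj : Spec.map (CommRingCat.ofHom (g.comp C)) = j ≫ h) :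
    letI := functionFieldAlgebra (f ≫ h)
    ∃ (ψ : S →+* X.functionField), RingHom.ker ψ = PrimeSpectrum.asIdeal z ∧
      (∀ p : k[X], ψ (g p) = aeval (ψ (g Polynomial.X)) p) ∧
      f.residueDegree (genericPoint X) =
        Module.finrank (IntermediateField.adjoin k {ψ (g Polynomial.X)}) X.functionField := by
  let := functionFieldAlgebra (f ≫ h)
  have hz' : (PrimeSpectrum.asIdeal z).IsPrime := z.2
  obtain ⟨φ, h1, h2⟩ := exists_isLocalization_stalk_of_eq j z (PrimeSpectrum.asIdeal z) rfl hz
  let := φ.hom.toAlgebra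
  let ψ' : S ⟶ X.functionField := φ ≫ f.stalkMap (genericPoint X)
  let ψ : S →+* X.functionField := ψ'.hom
  have hψ : CommRingCat.ofHom (g.comp C) ≫ ψ' = scalarToStalk (f ≫ h) (genericPoint X) := by
    apply eq_scalarToStalk
    rw [Spec.map_comp, hgj, Spec.map_comp, Category.assoc, reassoc_of% h1,
      Scheme.SpecMap_stalkMap_fromSpecStalk_assoc]
  have hψC : (ψ.comp g).comp C = algebraMap k X.functionField := congr(($hψ).hom)
  have hψg : ∀ p : k[X], ψ (g p) = aeval (ψ (g Polynomial.X)) p := by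
    have : ψ.comp g = (aeval (R := k) (ψ (g Polynomial.X))).toRingHom := by
      ext
      · simp only [AlgHom.toRingHom_eq_coe, RingHom.coe_comp, RingHom.coe_coe, Function.comp_apply,
          aeval_C]
        exact congr($hψC _)
      · simp
    exact fun p ↦ congr($this p)
  have hker : RingHom.ker ψ = PrimeSpectrum.asIdeal z := by
    ext s
    rw [RingHom.mem_ker, ← not_iff_not, ← ne_eq, ← isUnit_iff_ne_zero]
    change IsUnit ((f.stalkMap (genericPoint X)).hom (φ.hom s)) ↔ _
    rw [isUnit_map_iff]
    exact IsLocalization.AtPrime.isUnit_to_map_iff (Y.presheaf.stalk (f (genericPoint X)))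
      (PrimeSpectrum.asIdeal z) s
  refine ⟨ψ, hker, hψg, ?_⟩
  let r : X.functionField ≃+* X.residueField (genericPoint X) :=
    RingEquiv.ofBijective (X.residue (genericPoint X)).hom
      ⟨RingHom.injective (R := X.functionField) _, X.residue_surjective _⟩
  let θ : Y.residueField (f (genericPoint X)) →+* X.functionField :=
    r.symm.toRingHom.comp (f.residueFieldMap (genericPoint X)).hom
  have hθ : ∀ b, θ ((Y.residue (f (genericPoint X))).hom b) =
      (f.stalkMap (genericPoint X)).hom b := by
    intro b
    apply r.injective
    change r (r.symm _) = _
    rw [r.apply_symm_apply]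
    exact congr($(Scheme.residue_residueFieldMap f (genericPoint X)) b)
  have hθφ (s : S) : θ ((Y.residue (f (genericPoint X))).hom (φ.hom s)) = ψ s := hθ _
  have hmem (a) : θ a ∈ IntermediateField.adjoin k {ψ (g Polynomial.X)} := by
    obtain ⟨b, rfl⟩ := Y.residue_surjective _ a
    obtain ⟨⟨s, d⟩, hsd⟩ := IsLocalization.surj (PrimeSpectrum.asIdeal z).primeCompl b
    obtain ⟨p, rfl⟩ := hg s
    obtain ⟨p', hp'⟩ := hg d
    have h3 : (f.stalkMap (genericPoint X)).hom b * ψ (g p') = ψ (g p) := by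
      rw [hp']
      exact (map_mul _ _ _).symm.trans congr((f.stalkMap (genericPoint X)).hom $hsd)
    have h4 : ψ (g p') ≠ 0 := by
      intro h0
      rw [hp', ← RingHom.mem_ker, hker] at h0
      exact d.2 h0
    rw [IntermediateField.mem_adjoin_simple_iff]
    refine ⟨p, p', ?_⟩
    rw [← hψg, ← hψg, eq_div_iff h4, ← h3]
    exact congr($(hθ b) * _)
  let i : Y.residueField (f (genericPoint X)) ≃+*
      IntermediateField.adjoin k {ψ (g Polynomial.X)} :=
    RingEquiv.ofBijective (θ.codRestrict _ hmem) ⟨RingHom.injective _, by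
      rintro ⟨x, hx⟩
      obtain ⟨p, p', hpp'⟩ := IntermediateField.mem_adjoin_simple_iff _ _ |>.1 hx
      refine ⟨(Y.residue (f (genericPoint X))).hom (φ.hom (g p)) /
        (Y.residue (f (genericPoint X))).hom (φ.hom (g p')), Subtype.ext ?_⟩
      change θ _ = x
      rw [map_div₀, hθφ, hθφ, hψg p, hψg p', hpp']⟩
  let := (f.residueFieldMap (genericPoint X)).hom.toAlgebra
  exact Algebra.finrank_eq_of_equiv_equiv i r.symm rfl

lemma isMaximal_ker_of_isAlgebraic {k S F : Type*} [Field k] [CommRing S] [Field F] [Algebra k F]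
    (g : k[X] →+* S) (hg : Function.Surjective g) (ψ : S →+* F)
    (hψ : ∀ p : k[X], ψ (g p) = aeval (ψ (g Polynomial.X)) p)
    (ht : IsAlgebraic k (ψ (g Polynomial.X))) : (RingHom.ker ψ).IsMaximal := by
  rw [Ideal.isMaximal_iff]
  refine ⟨fun h1 ↦ by simp [RingHom.mem_ker] at h1, fun I s hI hs hsI ↦ ?_⟩
  obtain ⟨p, rfl⟩ := hg s
  have h1 : (ψ (g p))⁻¹ ∈ (IntermediateField.adjoin k {ψ (g Polynomial.X)}).toSubalgebra := by
    rw [hψ p, IntermediateField.mem_toSubalgebra, IntermediateField.mem_adjoin_simple_iff]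
    exact ⟨1, p, by simp⟩
  rw [IntermediateField.adjoin_simple_toSubalgebra_of_isAlgebraic ht,
    Algebra.adjoin_singleton_eq_range_aeval] at h1
  obtain ⟨p', hp'⟩ := h1
  have h2 : g p * g p' - 1 ∈ RingHom.ker ψ := by
    rw [RingHom.mem_ker, map_sub, map_mul, map_one, hψ p']
    change _ * (aeval _).toRingHom p' - 1 = 0
    rw [hp', mul_inv_cancel₀ hs, sub_self]
  have h3 : (1 : S) = g p * g p' - (g p * g p' - 1) := by ring
  rw [h3]
  exact I.sub_mem (I.mul_mem_right _ hsI) (hI h2)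

/-- The degree of a nonconstant morphism to a scheme which is locally a closed subscheme of the
affine line is the degree of the function field over a simple transcendental subextension. -/
lemma exists_transcendental_degree_eq_finrank [IsIntegral X]
    (hY : ∀ y : Y, ∃ (S : CommRingCat.{u}) (j : Spec S ⟶ Y) (_ : IsOpenImmersion j)
      (g : k[X] →+* S), Function.Surjective g ∧ y ∈ Set.range j ∧
      Spec.map (CommRingCat.ofHom (g.comp C)) = j ≫ h) (hf : IsNonconstant f) :
    letI := functionFieldAlgebra (f ≫ h)
    ∃ t : X.functionField, Transcendental k t ∧
      degree f = Module.finrank (IntermediateField.adjoin k {t}) X.functionField := by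
  let := functionFieldAlgebra (f ≫ h)
  have hdeg : degree f = f.residueDegree (genericPoint X) :=
    dif_pos (inferInstance : IrreducibleSpace X)
  by_contra! hcon
  have hconst (c : X) : f c = f (genericPoint X) := by
    obtain ⟨S, j, hj, g, hg, ⟨z', hz'⟩, hgj⟩ := hY (f c)
    have hspec : f (genericPoint X) ⤳ f c :=
      ((genericPoint_spec X).specializes trivial).map f.continuous
    obtain ⟨z, hz⟩ : f (genericPoint X) ∈ Set.range j :=
      hspec.mem_open j.isOpenEmbedding.isOpen_range ⟨z', hz'⟩
    obtain ⟨ψ, hψ1, hψ2, hψ3⟩ :=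
      exists_residueDegree_genericPoint_eq_finrank f h j z hz g hg hgj
    have halg : IsAlgebraic k (ψ (g Polynomial.X)) := by
      by_contra ht
      exact hcon _ ht (hdeg.trans hψ3)
    have hmax := isMaximal_ker_of_isAlgebraic g hg ψ hψ2 halg
    rw [hψ1] at hmax
    have hzz : z ⤳ z' := by
      rw [← j.isOpenEmbedding.isInducing.specializes_iff, hz, hz']
      exact hspec
    have hle : PrimeSpectrum.asIdeal z ≤ PrimeSpectrum.asIdeal z' :=
      (PrimeSpectrum.le_iff_specializes _ _).2 hzz
    have : z = z' := PrimeSpectrum.ext (hmax.eq_of_le (PrimeSpectrum.isPrime z').ne_top hle)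
    rw [← hz', ← hz, this]
  obtain ⟨_, ⟨a, rfl⟩, _, ⟨b, rfl⟩, hab⟩ := hf
  exact hab ((hconst a).trans (hconst b).symm)

end Degree

end CurveTower

namespace CurveTower

open Polynomial

section ProjectiveLine

attribute [local instance] MvPolynomial.gradedAlgebra

variable (k : Type u) [Field k]

/-- The grading by degree of the homogeneous coordinate ring of the projective line. -/
noncomputable abbrev binaryForms : ℕ → Submodule k (MvPolynomial (Fin 2) k) :=
  MvPolynomial.homogeneousSubmodule (Fin 2) k

lemma X_mem_binaryForms (i : Fin 2) :
    (MvPolynomial.X i : MvPolynomial (Fin 2) k) ∈ binaryForms k 1 :=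
  MvPolynomial.isHomogeneous_X k i

lemma adjoin_range_X_eq_top :
    Algebra.adjoin (binaryForms k 0)
      (Set.range (MvPolynomial.X : Fin 2 → MvPolynomial (Fin 2) k)) = ⊤ := by
  rw [eq_top_iff]
  intro p _
  induction p using MvPolynomial.induction_on with
  | C a => exact Subalgebra.algebraMap_mem _ (algebraMap k (binaryForms k 0) a)
  | add p q hp hq => exact add_mem (hp trivial) (hq trivial)
  | mul_X p n hp => exact mul_mem (hp trivial) (Algebra.subset_adjoin ⟨n, rfl⟩)

/-- The map from the polynomial ring in one variable to the coordinate ring of the chart of the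
projective line where the coordinate `i` does not vanish. -/
noncomputable def projectiveLineChart (i l : Fin 2) :
    k[X] →+* HomogeneousLocalization.Away (binaryForms k)
      (MvPolynomial.X i : MvPolynomial (Fin 2) k) :=
  Polynomial.eval₂RingHom
    ((HomogeneousLocalization.fromZeroRingHom (binaryForms k) _).comp
      (algebraMap k (binaryForms k 0)))
    (HomogeneousLocalization.Away.mk (binaryForms k) (X_mem_binaryForms k i) 1 (MvPolynomial.X l)
      (by simpa using X_mem_binaryForms k l))

lemma projectiveLineChart_surjective {i l : Fin 2} (hil : i ≠ l) :
    Function.Surjective (projectiveLineChart k i l) := by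
  have hzero (r : binaryForms k 0) : ∃ c : k, algebraMap k (binaryForms k 0) c = r := by
    obtain ⟨r, hr⟩ := r
    refine ⟨r.coeff 0, Subtype.ext ?_⟩
    exact (MvPolynomial.totalDegree_eq_zero_iff_eq_C.1
      (Nat.le_zero.1 (MvPolynomial.IsHomogeneous.totalDegree_le hr))).symm
  have htop := HomogeneousLocalization.Away.adjoin_mk_prod_pow_eq_top
    (X_mem_binaryForms k i) (Fin 2) MvPolynomial.X (adjoin_range_X_eq_top k) (fun _ ↦ 1)
    (X_mem_binaryForms k)
  intro x
  have hx : x ∈ (⊤ : Subalgebra (binaryForms k 0)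
      (HomogeneousLocalization.Away (binaryForms k) (MvPolynomial.X i))) := trivial
  rw [← htop] at hx
  induction hx using Algebra.adjoin_induction with
  | mem x hx =>
    obtain ⟨a, ai, hai, -, rfl⟩ := hx
    refine ⟨Polynomial.X ^ ai l, ?_⟩
    simp only [projectiveLineChart, coe_eval₂RingHom, eval₂_pow, eval₂_X]
    apply HomogeneousLocalization.val_injective
    rw [HomogeneousLocalization.val_pow, HomogeneousLocalization.Away.val_mk,
      HomogeneousLocalization.Away.val_mk, Localization.mk_pow, Localization.mk_eq_mk_iff,
      Localization.r_iff_exists]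
    refine ⟨1, ?_⟩
    have huniv : (Finset.univ : Finset (Fin 2)) = {i, l} :=
      (show ∀ i l : Fin 2, i ≠ l → Finset.univ = {i, l} by decide) i l hil
    rw [huniv, Finset.sum_pair hil] at hai
    rw [huniv, Finset.prod_pair hil]
    simp only [smul_eq_mul, mul_one] at hai
    simp [← hai]
    ring
  | algebraMap r =>
    obtain ⟨c, rfl⟩ := hzero r
    exact ⟨Polynomial.C c, by simp [projectiveLineChart]; rfl⟩
  | add x y _ _ hx hy =>
    obtain ⟨p, rfl⟩ := hx
    obtain ⟨q, rfl⟩ := hy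
    exact ⟨p + q, map_add _ _ _⟩
  | mul x y _ _ hx hy =>
    obtain ⟨p, rfl⟩ := hx
    obtain ⟨q, rfl⟩ := hy
    exact ⟨p * q, map_mul _ _ _⟩

lemma exists_chart_projectiveLine (y : (projectiveSpace k 1).left) :
    ∃ (S : CommRingCat.{u}) (j : Spec S ⟶ (projectiveSpace k 1).left) (_ : IsOpenImmersion j)
      (g : k[X] →+* S), Function.Surjective g ∧ y ∈ Set.range j ∧
      Spec.map (CommRingCat.ofHom (g.comp C)) = j ≫ (projectiveSpace k 1).hom := by
  have hcov : ∀ y : Proj (binaryForms k), ∃ i,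
      y ∈ Proj.basicOpen (binaryForms k) (MvPolynomial.X i) := by
    intro y
    rw [← TopologicalSpace.Opens.mem_iSup, Proj.iSup_basicOpen_eq_top' (binaryForms k) _
      (fun i ↦ ⟨1, X_mem_binaryForms k i⟩) (adjoin_range_X_eq_top k)]
    trivial
  obtain ⟨i, hi⟩ := hcov y
  obtain ⟨l, hil⟩ : ∃ l, i ≠ l := (exists_ne i).imp fun _ h ↦ h.symm
  have hopen : IsOpenImmersion (Proj.awayι (binaryForms k) _ (X_mem_binaryForms k i) one_pos) :=
    inferInstance
  refine ⟨_, Proj.awayι (binaryForms k) _ (X_mem_binaryForms k i) one_pos, hopen,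
    projectiveLineChart k i l, projectiveLineChart_surjective k hil, ?_, ?_⟩
  · have := Proj.opensRange_awayι (binaryForms k) _ (X_mem_binaryForms k i) one_pos
    rw [← this] at hi
    exact hi
  · change _ = _ ≫ Proj.toSpecZero (binaryForms k) ≫ _
    rw [Proj.awayι_toSpecZero_assoc, ← Spec.map_comp]
    congr 1
    ext c
    simp [projectiveLineChart]

end ProjectiveLine

end CurveTower

namespace CurveTower

open IsLocalRing TensorProduct

section GenericFibre

variable {R K B F : Type*} [CommRing R] [Field K] [Algebra R K] [IsFractionRing R K]
  [CommRing B] [Algebra R B] [Field F]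

/-- A flat algebra over a domain has the same field of fractions as its generic fibre. -/
lemma isFractionRing_of_isFractionRing_baseChange [Module.Flat R B] [Algebra (B ⊗[R] K) F]
    [IsFractionRing (B ⊗[R] K) F] [Algebra B F] [IsScalarTower B (B ⊗[R] K) F] :
    IsFractionRing B F := by
  have hinj : Function.Injective (algebraMap B (B ⊗[R] K)) :=
    Algebra.TensorProduct.includeLeft_injective (S := B) (IsFractionRing.injective R K)
  have hinjF : Function.Injective (algebraMap B F) := by
    rw [IsScalarTower.algebraMap_eq B (B ⊗[R] K) F]
    exact (IsFractionRing.injective (B ⊗[R] K) F).comp hinj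
  have : FaithfulSMul B F := (faithfulSMul_iff_algebraMap_injective B F).2 hinjF
  have : IsDomain (B ⊗[R] K) := (IsFractionRing.injective (B ⊗[R] K) F).isDomain _
  have hfrac (z : B ⊗[R] K) : ∃ x y, algebraMap B F y ≠ 0 ∧
      algebraMap _ F z = algebraMap B F x / algebraMap B F y := by
    obtain ⟨⟨x, y⟩, hxy⟩ :=
      IsLocalization.surj (Algebra.algebraMapSubmonoid B (nonZeroDivisors R)) z
    have hy : algebraMap B F y ≠ 0 := by
      have h1 := (IsLocalization.map_units (B ⊗[R] K) y).map (algebraMap (B ⊗[R] K) F)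
      rw [← IsScalarTower.algebraMap_apply] at h1
      exact h1.ne_zero
    refine ⟨x, y, hy, ?_⟩
    rw [eq_div_iff hy, IsScalarTower.algebraMap_apply B (B ⊗[R] K) F,
      IsScalarTower.algebraMap_apply B (B ⊗[R] K) F, ← map_mul, hxy]
  refine IsFractionRing.of_field B F fun z ↦ ?_
  obtain ⟨a, b, hb, rfl⟩ := IsFractionRing.div_surjective (A := B ⊗[R] K) z
  obtain ⟨a₁, a₂, ha₂, ha⟩ := hfrac a
  obtain ⟨b₁, b₂, hb₂, hb⟩ := hfrac b
  refine ⟨a₁ * b₂, a₂ * b₁, ?_⟩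
  rw [ha, hb, map_mul, map_mul, div_div_div_eq]

end GenericFibre

section SpecialFibre

variable {R B L : Type*} [CommRing R] [IsLocalRing R] [CommRing B] [Algebra R B] [Field L]

lemma residueField_includeLeft_surjective :
    Function.Surjective (algebraMap B (B ⊗[R] ResidueField R)) := by
  intro x
  obtain ⟨y, rfl⟩ :=
    (Algebra.TensorProduct.quotIdealMapEquivTensorQuot B (maximalIdeal R)).surjective x
  obtain ⟨b, rfl⟩ := Ideal.Quotient.mk_surjective y
  exact ⟨b, ((Algebra.TensorProduct.quotIdealMapEquivTensorQuot B (maximalIdeal R)).commutes b).symm⟩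

lemma residueField_ker_includeLeft :
    RingHom.ker (algebraMap B (B ⊗[R] ResidueField R)) =
      (maximalIdeal R).map (algebraMap R B) := by
  ext b
  have h := (Algebra.TensorProduct.quotIdealMapEquivTensorQuot B (maximalIdeal R)).commutes b
  rw [RingHom.mem_ker, ← Ideal.Quotient.eq_zero_iff_mem,
    ← (Algebra.TensorProduct.quotIdealMapEquivTensorQuot B (maximalIdeal R)).map_eq_zero_iff]
  exact Eq.congr_left h.symm

end SpecialFibre

section Flat

variable {R K B F L : Type*} [CommRing R] [IsDomain R] [IsDiscreteValuationRing R] [Field K]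
  [Algebra R K] [IsFractionRing R K] [CommRing B] [IsNoetherianRing B] [Algebra R B]
  [Field F] [Algebra K F] [Field L] [Algebra (ResidueField R) L]

/-- Bound for the number of rational places of the special fibre of a flat affine chart by the
degree of a rational function on the generic fibre. -/
theorem card_le_mul_finrank_adjoin_of_isFractionRing [Algebra B F] [IsFractionRing B F]
    (hBF : (algebraMap B F).comp (algebraMap R B) = (algebraMap K F).comp (algebraMap R K))
    (β : B →+* L)
    (hβ : β.comp (algebraMap R B) = (algebraMap (ResidueField R) L).comp (residue R))
    (hker : RingHom.ker β = (maximalIdeal R).map (algebraMap R B))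
    (hfrac : ∀ x : L, ∃ a b, β b ≠ 0 ∧ x = β a / β b)
    [Finite (ResidueField R)] {s : L} (hs : Transcendental (ResidueField R) s)
    (t : F) (ht : Transcendental K t) [FiniteDimensional (IntermediateField.adjoin K {t}) F]
    {ι : Type*} (V : ι → ValuationSubring L) [∀ i, IsDiscreteValuationRing (V i)]
    (hV : Function.Injective V) (hk : ∀ i c, algebraMap (ResidueField R) L c ∈ V i)
    (hVk : ∀ i, ∀ x ∈ V i, ∃ c : ResidueField R, (V i).valuation (x - algebraMap _ L c) < 1) :
    Nat.card ι ≤ (Nat.card (ResidueField R) + 1) *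
      Module.finrank (IntermediateField.adjoin K {t}) F := by
  cases finite_or_infinite ι
  swap
  · simp
  have : IsDomain B := (IsFractionRing.injective B F).isDomain _
  obtain ⟨π, hπ⟩ := IsDiscreteValuationRing.exists_irreducible R
  have hmax := (IsDiscreteValuationRing.irreducible_iff_uniformizer π).1 hπ
  rw [hmax, Ideal.map_span, Set.image_singleton] at hker
  have hprime : (RingHom.ker β).IsPrime := RingHom.ker_isPrime β
  let A := Localization.AtPrime (RingHom.ker β)
  have hunit : ∀ y : (RingHom.ker β).primeCompl, IsUnit (β y) := fun y ↦ Ne.isUnit y.2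
  let ρ : A →+* L := IsLocalization.lift hunit
  have hρβ (b : B) : ρ (algebraMap B A b) = β b := IsLocalization.lift_eq hunit b
  have hle : (RingHom.ker β).primeCompl ≤ nonZeroDivisors B := by
    intro b hb
    exact mem_nonZeroDivisors_of_ne_zero fun h ↦ hb (by rw [h]; exact map_zero β)
  have hunitF : ∀ y : (RingHom.ker β).primeCompl, IsUnit (algebraMap B F y) := fun y ↦
    IsLocalization.map_units F (⟨y, hle y.2⟩ : nonZeroDivisors B)
  let : Algebra A F := (IsLocalization.lift hunitF : A →+* F).toAlgebra
  have hAF (b : B) : algebraMap A F (algebraMap B A b) = algebraMap B F b :=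
    IsLocalization.lift_eq hunitF b
  have : IsScalarTower B A F := .of_algebraMap_eq fun b ↦ (hAF b).symm
  have : IsFractionRing A F :=
    IsFractionRing.isFractionRing_of_isDomain_of_isLocalization (RingHom.ker β).primeCompl A F
  have : IsDomain A := (IsFractionRing.injective A F).isDomain _
  have : IsNoetherianRing A :=
    IsLocalization.isNoetherianRing (RingHom.ker β).primeCompl A inferInstance
  let : Algebra R F := ((algebraMap K F).comp (algebraMap R K)).toAlgebra
  have : IsScalarTower R K F := .of_algebraMap_eq' rfl
  have hRA (r : R) : algebraMap R A r = algebraMap B A (algebraMap R B r) :=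
    IsScalarTower.algebraMap_apply R B A r
  have : IsScalarTower R A F := .of_algebraMap_eq fun r ↦ by
    rw [hRA, hAF]
    exact congr($hBF.symm r)
  have hmaxA : maximalIdeal A = Ideal.span {algebraMap R A π} := by
    rw [← IsLocalization.AtPrime.map_eq_maximalIdeal (RingHom.ker β) A, hRA]
    simp only [hker, Ideal.map_span, Set.image_singleton]
  have hπ0 : algebraMap R A π ≠ 0 := by
    intro h0
    have h1 : algebraMap A F (algebraMap R A π) = 0 := by rw [h0, map_zero]
    rw [← IsScalarTower.algebraMap_apply R A F, IsScalarTower.algebraMap_apply R K F,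
      map_eq_zero, (IsFractionRing.injective R K).eq_iff' (map_zero _)] at h1
    exact hπ.ne_zero h1
  have : IsDiscreteValuationRing A :=
    isDiscreteValuationRing_of_maximalIdeal_eq_span_singleton hπ0 hmaxA
  have hρA (r : R) : ρ (algebraMap R A r) = algebraMap _ L (residue R r) := by
    rw [hRA, hρβ]
    exact congr($hβ r)
  refine card_le_mul_finrank_adjoin (R := R) (A := A) ρ ?_ hρA hπ
    ((IsDiscreteValuationRing.irreducible_iff_uniformizer _).2 hmaxA) (fun a ↦ ⟨fun ha ↦ ?_, ?_⟩)
    hs t ht V hV hk hVk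
  · intro x
    obtain ⟨a, b, hb, rfl⟩ := hfrac x
    refine ⟨IsLocalization.mk' A a (⟨b, hb⟩ : (RingHom.ker β).primeCompl), ?_⟩
    rw [eq_div_iff hb, ← hρβ b, ← map_mul, IsLocalization.mk'_spec, hρβ]
  · rw [← Ideal.mem_span_singleton, ← hmaxA, mem_maximalIdeal, mem_nonunits_iff]
    exact fun hu ↦ (hu.map ρ).ne_zero ha
  · rintro ⟨c, rfl⟩
    rw [map_mul, hρA, (residue_eq_zero_iff π).2 ((mem_maximalIdeal _).2 hπ.not_isUnit), map_zero,
      zero_mul]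

end Flat

end CurveTower

namespace CurveTower

open IsLocalRing TensorProduct

section Chart

variable {R : Type u} [CommRing R] (X : Over (Spec (.of R)))

/-- The base change of an affine chart is an affine chart of the base change. -/
lemma exists_baseChange_chart (S B : Type u) [CommRing S] [Algebra R S] [CommRing B] [Algebra R B]
    (j : Spec (.of B) ⟶ X.left) [IsOpenImmersion j]
    (hj : j ≫ X.hom = Spec.map (CommRingCat.ofHom (algebraMap R B))) :
    ∃ jS : Spec (.of (B ⊗[R] S)) ⟶ ((baseChange R S).obj X).left, IsOpenImmersion jS ∧
      jS ≫ ((baseChange R S).obj X).hom = Spec.map (CommRingCat.ofHom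
        (Algebra.TensorProduct.includeRight : S →ₐ[R] B ⊗[R] S).toRingHom) := by
  let J : Over.mk (Spec.map (CommRingCat.ofHom (algebraMap R B))) ⟶ X := Over.homMk j hj
  have hJ : IsOpenImmersion ((baseChange R S).map J).left :=
    MorphismProperty.overPullbackMap (P := @IsOpenImmersion) _ J ‹_›
  refine ⟨(pullbackSpecIso R B S).inv ≫ ((baseChange R S).map J).left, ?_, ?_⟩
  · exact IsOpenImmersion.comp _ _
  · rw [Category.assoc, Over.w]
    exact pullbackSpecIso_inv_snd R B S

/-- A scheme over a local ring with nonempty special fibre has an affine chart meeting the special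
fibre. -/
lemma exists_chart_nontrivial_baseChange [IsLocalRing R]
    [Nonempty ((baseChange R (ResidueField R)).obj X).left] :
    ∃ (B : Type u) (_ : CommRing B) (_ : Algebra R B) (j : Spec (.of B) ⟶ X.left),
      IsOpenImmersion j ∧ j ≫ X.hom = Spec.map (CommRingCat.ofHom (algebraMap R B)) ∧
      Nontrivial (B ⊗[R] ResidueField R) := by
  obtain ⟨x⟩ := ‹Nonempty ((baseChange R (ResidueField R)).obj X).left›
  let i := Spec.map (CommRingCat.ofHom (algebraMap R (ResidueField R)))
  let x₁ : X.left := pullback.fst X.hom i x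
  let x₂ : Spec (.of (ResidueField R)) := pullback.snd X.hom i x
  have hx : X.hom x₁ = i x₂ := by
    rw [← Scheme.Hom.comp_apply, ← Scheme.Hom.comp_apply, pullback.condition]
  obtain ⟨B, j, hj, ⟨b, hb⟩, -⟩ := Scheme.exists_affine_mem_range_and_range_subset
    (X := X.left) (x := x₁) (U := ⊤) trivial
  let χ : CommRingCat.of R ⟶ B := Spec.preimage (j ≫ X.hom)
  have hχ : Spec.map χ = j ≫ X.hom := Spec.map_preimage _
  let : Algebra R B := χ.hom.toAlgebra
  refine ⟨B, inferInstance, inferInstance, j, hj, hχ.symm, ?_⟩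
  have hbx : Spec.map (CommRingCat.ofHom (algebraMap R B)) b = i x₂ := by
    rw [← hx, ← hb, ← Scheme.Hom.comp_apply, ← hχ]
    rfl
  obtain ⟨z, -, -⟩ := Scheme.Pullback.exists_preimage_pullback _ _ hbx
  exact PrimeSpectrum.nonempty_iff_nontrivial.1 ⟨(pullbackSpecIso R B (ResidueField R)).hom z⟩

end Chart

section Model

variable {R K : Type u} [CommRing R] [IsDomain R] [IsDiscreteValuationRing R]
  [Finite (ResidueField R)] [Field K] [Algebra R K] [IsFractionRing R K]

/-- The number of rational points on the special fibre of a model of a curve is bounded by the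
degree of any nonconstant morphism from the curve to the projective line. -/
theorem card_rationalPoint_le (X : Over (Spec (.of R))) [Flat X.hom] [IsProper X.hom]
    (hX : IsCurve ((baseChange R (ResidueField R)).obj X)) {C : Over (Spec (.of K))}
    (hC : IsCurve C) (e : (baseChange R K).obj X ≅ C) (f : C ⟶ projectiveSpace K 1)
    (hf : IsNonconstant f.left) :
    Nat.card (RationalPoint ((baseChange R (ResidueField R)).obj X)) ≤
      (Nat.card (ResidueField R) + 1) * degree f.left := by
  let Xs := (baseChange R (ResidueField R)).obj X
  have := hX.smooth
  have := hX.geometricallyConnected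
  have := hC.smooth
  have := hC.geometricallyConnected
  have : AlgebraicGeometry.IsIntegral Xs.left := isIntegral_of_smooth Xs.hom
  have : AlgebraicGeometry.IsIntegral C.left := isIntegral_of_smooth C.hom
  have : IsSeparated Xs.hom :=
    inferInstanceAs (IsSeparated (pullback.snd X.hom
      (Spec.map (CommRingCat.ofHom (algebraMap R (ResidueField R))))))
  obtain ⟨B, _, _, j, hj, hjX, hnt⟩ := exists_chart_nontrivial_baseChange X
  have hflat : Module.Flat R B := by
    have : Flat (j ≫ X.hom) := inferInstance
    rw [hjX, Flat.SpecMap_iff] at this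
    exact RingHom.flat_algebraMap_iff.1 this
  have hft : Algebra.FiniteType R B := by
    have : LocallyOfFiniteType (j ≫ X.hom) := inferInstance
    rw [hjX, HasRingHomProperty.Spec_iff (P := @LocallyOfFiniteType)] at this
    exact RingHom.finiteType_algebraMap.1 this
  have : IsNoetherianRing B := Algebra.FiniteType.isNoetherianRing R B
  have hinj : Function.Injective (algebraMap B (B ⊗[R] K)) :=
    Algebra.TensorProduct.includeLeft_injective (S := B) (IsFractionRing.injective R K)
  have : Nontrivial B := (algebraMap B (B ⊗[R] ResidueField R)).domain_nontrivial
  have : Nontrivial (B ⊗[R] K) := hinj.nontrivial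
  obtain ⟨js, hjs, hjs'⟩ := exists_baseChange_chart X (ResidueField R) B j hjX
  obtain ⟨jK, hjK, hjK'⟩ := exists_baseChange_chart X K B j hjX
  have : Nonempty (Spec (.of (B ⊗[R] ResidueField R))) :=
    PrimeSpectrum.nonempty_iff_nontrivial.2 hnt
  have : Nonempty (Spec (.of (B ⊗[R] K))) := PrimeSpectrum.nonempty_iff_nontrivial.2 inferInstance
  have : IsOpenImmersion (jK ≫ e.hom.left) := by
    have : IsIso e.hom.left := inferInstanceAs (IsIso ((Over.forget _).map e.hom))
    exact IsOpenImmersion.comp _ _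
  obtain ⟨-, φs, hφs, hfracs⟩ := exists_isFractionRing_functionField (X := Xs.left) js
  obtain ⟨-, φK, hφK, hfracK⟩ := exists_isFractionRing_functionField (jK ≫ e.hom.left)
  let := functionFieldAlgebra Xs.hom
  let := functionFieldAlgebra C.hom
  have hs : φs.hom.comp (Algebra.TensorProduct.includeRight :
      ResidueField R →ₐ[R] B ⊗[R] ResidueField R).toRingHom = algebraMap _ Xs.left.functionField := by
    have h : CommRingCat.ofHom (Algebra.TensorProduct.includeRight :
        ResidueField R →ₐ[R] B ⊗[R] ResidueField R).toRingHom ≫ φs = scalarToStalk Xs.hom _ := by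
      apply eq_scalarToStalk
      rw [Spec.map_comp, ← hjs', ← Category.assoc, hφs]
    exact congr(($h).hom)
  have hK : φK.hom.comp (Algebra.TensorProduct.includeRight :
      K →ₐ[R] B ⊗[R] K).toRingHom = algebraMap _ C.left.functionField := by
    have h : CommRingCat.ofHom (Algebra.TensorProduct.includeRight :
        K →ₐ[R] B ⊗[R] K).toRingHom ≫ φK = scalarToStalk C.hom _ := by
      apply eq_scalarToStalk
      rw [Spec.map_comp, ← hjK', ← hφK, Category.assoc, Category.assoc, Over.w]
    exact congr(($h).hom)
  obtain ⟨t, ht, hdeg⟩ : ∃ t : C.left.functionField, Transcendental K t ∧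
      degree f.left = Module.finrank (IntermediateField.adjoin K {t}) C.left.functionField := by
    have key : ∀ h : C.left ⟶ Spec (.of K), f.left ≫ (projectiveSpace K 1).hom = h →
        letI := functionFieldAlgebra h
        ∃ t : C.left.functionField, Transcendental K t ∧
        degree f.left = Module.finrank (IntermediateField.adjoin K {t}) C.left.functionField := by
      rintro _ rfl
      exact exists_transcendental_degree_eq_finrank f.left (projectiveSpace K 1).hom
        (exists_chart_projectiveLine K) hf
    exact key C.hom (Over.w f)
  have := finiteDimensional_functionField C.hom t ht
  obtain ⟨s, hs'⟩ := exists_transcendental_functionField Xs.hom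
  obtain ⟨V, hV, hVdvr, hVk, hVres⟩ := exists_valuationSubring_family Xs.hom
    (fun p : RationalPoint Xs ↦ p.left) (fun p q h ↦ Over.OverMorphism.ext h) (fun p ↦ Over.w p)
  let := φK.hom.toAlgebra
  let : Algebra B C.left.functionField := (φK.hom.comp (algebraMap B (B ⊗[R] K))).toAlgebra
  have : IsScalarTower B (B ⊗[R] K) C.left.functionField := .of_algebraMap_eq' rfl
  have : IsFractionRing B C.left.functionField :=
    isFractionRing_of_isFractionRing_baseChange (R := R) (K := K)
  rw [hdeg]
  let β : B →+* Xs.left.functionField := φs.hom.comp (algebraMap B (B ⊗[R] ResidueField R))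
  let := φs.hom.toAlgebra
  have hφinj : Function.Injective φs.hom :=
    IsFractionRing.injective (B ⊗[R] ResidueField R) Xs.left.functionField
  refine card_le_mul_finrank_adjoin_of_isFractionRing (B := B) (K := K) ?_ β ?_ ?_ ?_ hs' t ht V hV
    hVk hVres
  · rw [← hK]
    ext r
    change φK.hom (algebraMap R B r ⊗ₜ 1) = φK.hom (1 ⊗ₜ algebraMap R K r)
    rw [Algebra.algebraMap_eq_smul_one, Algebra.algebraMap_eq_smul_one, TensorProduct.smul_tmul]
  · rw [← hs]
    ext r
    change φs.hom (algebraMap R B r ⊗ₜ 1) = φs.hom (1 ⊗ₜ algebraMap R (ResidueField R) r)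
    rw [Algebra.algebraMap_eq_smul_one, Algebra.algebraMap_eq_smul_one, TensorProduct.smul_tmul]
  · rw [← residueField_ker_includeLeft]
    ext b
    exact map_eq_zero_iff _ hφinj
  · intro x
    obtain ⟨a, b, hb, rfl⟩ := IsFractionRing.div_surjective (A := B ⊗[R] ResidueField R) x
    obtain ⟨a, rfl⟩ := residueField_includeLeft_surjective a
    obtain ⟨b, rfl⟩ := residueField_includeLeft_surjective b
    exact ⟨a, b, IsFractionRing.to_map_ne_zero_of_mem_nonZeroDivisors hb, rfl⟩

end Model

end CurveTower

namespace CurveTower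

open IsLocalRing

section NumberField

variable (K : Type u) [Field K] [NumberField K] (v : HeightOneSpectrum (𝓞 K))

instance isDiscreteValuationRing_localRingAt : IsDiscreteValuationRing (localRingAt K v) :=
  IsLocalization.AtPrime.isDiscreteValuationRing_of_dedekind_domain (𝓞 K) v.ne_bot _

instance finite_residueField_localRingAt : Finite (ResidueField (localRingAt K v)) := by
  have : Finite (𝓞 K ⧸ v.asIdeal) := v.asIdeal.finiteQuotientOfFreeOfNeBot v.ne_bot
  exact .of_equiv _
    (IsLocalization.AtPrime.equivQuotMaximalIdeal v.asIdeal (localRingAt K v)).toEquiv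

end NumberField

lemma le_gonality {k : Type u} [Field k] {C : Over (Spec (.of k))} {m : ℕ}
    (h : ∀ f : C ⟶ projectiveSpace k 1, IsNonconstant f.left → m ≤ degree f.left) :
    (m : ℕ∞) ≤ gonality C := by
  refine le_sInf ?_
  rintro _ ⟨f, hf, rfl⟩
  exact_mod_cast h f hf

end CurveTower

theorem mainTheorem8 (K : Type u) [Field K] [NumberField K] (T : CurveTower.Tower K)
    (v : HeightOneSpectrum (𝓞 K))
    (M : CurveTower.ProperModel T (CurveTower.localRingAt K v))
    (hM : M.HasGoodReduction)
    (hlim : Tendsto (fun n ↦ Nat.card (CurveTower.RationalPoint (M.reduction n))) atTop atTop) :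
    T.gonality = ⊤ := by
  refine Tendsto.limsup_eq (ENat.tendsto_nhds_top_iff_natCast_lt.2 fun m ↦ ?_)
  let q := Nat.card (IsLocalRing.ResidueField (CurveTower.localRingAt K v))
  filter_upwards [hlim.eventually_ge_atTop ((q + 1) * (m + 1))] with n hn
  refine lt_of_lt_of_le (by exact_mod_cast Nat.lt_succ_self m)
    (CurveTower.le_gonality (m := m + 1) fun f hf ↦ ?_)
  have := M.flat n
  have := M.proper n
  exact Nat.le_of_mul_le_mul_left
    (hn.trans (CurveTower.card_rationalPoint_le (M.model n) (hM.isCurve n) (T.isCurve n)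
      (M.genericFibreIso n) f hf)) q.succ_pos
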